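/- **Conventions.** Let $\{\Phi_e\}_{e\in\mathbb N}$ be an effective enumeration of all Turing functionals on $\mathbb N^{\mathbb N}$. A *learner* is a total computable function $\Psi:\mathbb N^{<\mathbb N}\to\mathbb N$. A partial function $\Gamma:\subseteq\mathbb N^{\mathbb N}\to\mathbb N^{\mathbb N}$ is *identified* by $\Psi$ if for every $g\in\operatorname{dom}\Gamma$ the limit $e=\lim_n\Psi(g\upharpoonright n)$ exists and $\Phi_e(g)=\Gamma(g)$. For $P,Q\subseteq\mathbb N^{\mathbb N}$ write $P\le^1_{<\omega}Q$ if there is a partial function $\Gamma$, defined on all of $Q$ and mapping $Q$ into $P$, that is identified by a learner $\Psi$ for which $\#\{n:\Psi(g\upharpoonright (n+1))\neq\Psi(g\upharpoonright n)\}$ is bounded over all $g\in\operatorname{dom}\Gamma$ (bounded mind changes). Write $P\le^1_{\omega|<\omega}Q$ if there is such a $\Gamma$ identified by a learner $\Psi$ for which $\#\{\Psi(g\upharpoonright n):n\in\mathbb N\}$ is bounded over all $g\in\operatorname{dom}\Gamma$ (bounded errors). For either preorder, $P<Q$ means $P\le Q$ and $Q\not\le P$, and $P\equiv Q$ means $P\le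 Q$ and $Q\le P$. A set $P\subseteq 2^{\mathbb N}$ is $\Pi^0_1$ if it is the set of infinite paths of a computable tree $T\subseteq 2^{<\mathbb N}$; such a $T$ is called a tree for $P$. Let $T_P,T_Q$ be trees for $P,Q$, and let $L_P,L_Q$ be their sets of leaves. Put $P\oplus Q=(\langle0\rangle^\frown P)\cup(\langle1\rangle^\frown Q)$ and $P^\frown Q=P\cup\bigcup_{\rho\in L_P}\rho^\frown Q$ (similarly $Q^\frown P$, with $L_Q$), and let the *commutative concatenation* be $P\,\nabla\,Q=(P^\frown Q)\oplus(Q^\frown P)$. For $f\in(\{0,1\}\times\mathbb N)^{\mathbb N}$ let $\mathrm{pr}_i(f)$ be the (finite or infinite) sequence of the $x$ such that $(i,x)$ is listed by $f$, in order, and let $\mathrm{mc}(f)$ be the number of $n$ at which $f(n)$ and $f(n+1)$ have different first coordinates. For $n\in\mathbb N\cup\{\omega\}$ let $P\,\nabla_n\,Q$ be the set of all $f\in(\{0,1\}\times\mathbb N)^{\mathbb N}$ such that $\mathrm{pr}_0(f)\in P$ or $\mathrm{pr}_1(f)\in Q$, such that $\mathrm{mc}(f)<n$ (for $n=\omega$: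 $\mathrm{mc}(f)$ is finite), and such that all finite initial segments of $\mathrm{pr}_0(f)$ are in $T_P$ and all those of $\mathrm{pr}_1(f)$ are in $T_Q$. It is regarded as a subset of $\mathbb N^{\mathbb N}$ through a computable pairing function. **Corollary.** 1. There are nonempty $\Pi^0_1$ sets $P,Q\subseteq2^{\mathbb N}$ such that, for every choice of trees for $P$ and for $Q$, $P\,\nabla_\omega\,Q<^1_{<\omega}P\,\nabla\,Q$ and $P\,\nabla_\omega\,Q<^1_{<\omega}P\,\nabla_2\,Q$. 2. There are nonempty $\Pi^0_1$ sets $P,Q\subseteq2^{\mathbb N}$ such that $P\equiv^1_{\omega|<\omega}Q$ and $P<^1_{<\omega}Q$. (In particular there is a function from $P$ to $Q$ that is learnable with bounded errors, but none that is learnable with bounded mind changes.) -/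

import Mathlib

namespace MassProblem

/-- Baire space. -/
abbrev Baire : Type := ℕ → ℕ

/-- The initial segment of `f` of length `n`. -/
def res (f : Baire) (n : ℕ) : List ℕ := (List.range n).map f

/-- The concatenation of a finite string and an infinite sequence. -/
def cat (σ : List ℕ) (f : Baire) : Baire :=
  fun n => if h : n < σ.length then σ[n] else f (n - σ.length)

/-! ### Turing functionals -/

/-- The `e`-th Turing functional with oracle `g` on input `n`.  The program with index `e` is run on
`(g ↾ 0, n)`, `(g ↾ 1, n)`, `(g ↾ 2, n)`, … in turn; as long as it answers `0`, a longer part of the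
oracle is inspected; the first nonzero answer `m + 1` ends the computation with output `m`; if one of
these runs diverges, or if all answers are `0`, then the computation diverges. -/
def Phi (e : ℕ) (g : Baire) (n : ℕ) : Part ℕ :=
  let run : ℕ → Part ℕ := fun s =>
    (Denumerable.ofNat Nat.Partrec.Code e).eval (Nat.pair (Encodable.encode (res g s)) n)
  (Nat.rfind fun s => (run s).map fun v => decide (v ≠ 0)).bind fun s => (run s).map Nat.pred

/-- `Φ_e(g)` is total and equal to `f`. -/
def Computes (e : ℕ) (g f : Baire) : Prop := ∀ n, f n ∈ Phi e g n

/-! ### Learners and the classes of learnable functions -/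

/-- The set of mind-change locations of the learner `Ψ` on the informant `g`. -/
def mcl (Ψ : List ℕ → ℕ) (g : Baire) : Set ℕ := {n | Ψ (res g (n + 1)) ≠ Ψ (res g n)}

/-- The set of indices predicted by the learner `Ψ` on the informant `g`. -/
def indx (Ψ : List ℕ → ℕ) (g : Baire) : Set ℕ := Set.range fun n => Ψ (res g n)

/-- The partial function `Γ` is identified by the learner `Ψ`: on every `g` in the domain of `Γ` the
predictions of `Ψ` converge to an index `e` with `Φ_e(g) = Γ(g)`. -/
def IdentifiedBy (Γ : Baire →. Baire) (Ψ : List ℕ → ℕ) : Prop :=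
  ∀ g, ∀ f ∈ Γ g, ∃ e, (∀ᶠ n in Filter.atTop, Ψ (res g n) = e) ∧ Computes e g f

/-- The `(1, <ω)`-computable partial functions: learnable with bounded mind changes. -/
def boundedMindChanges : Set (Baire →. Baire) :=
  {Γ | ∃ Ψ : List ℕ → ℕ, Computable Ψ ∧ IdentifiedBy Γ Ψ ∧
    ∃ b : ℕ, ∀ g ∈ Γ.Dom, (mcl Ψ g).encard ≤ b}

/-- The `(1, ω|<ω)`-computable partial functions: learnable with bounded errors. -/
def boundedErrors : Set (Baire →. Baire) :=
  {Γ | ∃ Ψ : List ℕ → ℕ, Computable Ψ ∧ IdentifiedBy Γ Ψ ∧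
    ∃ b : ℕ, ∀ g ∈ Γ.Dom, (indx Ψ g).encard ≤ b}

/-- `P ≤_F Q`: some partial function in `F` is defined on all of `Q` and maps `Q` into `P`. -/
def Below (F : Set (Baire →. Baire)) (P Q : Set Baire) : Prop :=
  ∃ Γ ∈ F, ∀ g ∈ Q, ∃ f ∈ Γ g, f ∈ P

/-- `P ≡_F Q`. -/
def Equivalent (F : Set (Baire →. Baire)) (P Q : Set Baire) : Prop := Below F P Q ∧ Below F Q P

/-- `P <_F Q`. -/
def StrictlyBelow (F : Set (Baire →. Baire)) (P Q : Set Baire) : Prop :=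
  Below F P Q ∧ ¬ Below F Q P

/-! ### `Π⁰₁` subsets of Cantor space and their trees -/

/-- The set of infinite paths of `T`. -/
def paths (T : Set (List ℕ)) : Set Baire := {f | ∀ n, res f n ∈ T}

/-- `T` is a computable tree of binary strings whose set of infinite paths is `P`. -/
structure IsTreeFor (T : Set (List ℕ)) (P : Set Baire) : Prop where
  binary : ∀ σ ∈ T, ∀ x ∈ σ, x < 2
  prefix_closed : ∀ σ τ, σ <+: τ → τ ∈ T → σ ∈ T
  computable : ComputablePred fun σ => σ ∈ T
  paths_eq : paths T = P

/-- `P` is a `Π⁰₁` subset of Cantor space (the space of the sequences with all values below `2`). -/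
def IsPi01 (P : Set Baire) : Prop := ∃ T, IsTreeFor T P

/-- The leaves (dead ends) of `T`. -/
def leaves (T : Set (List ℕ)) : Set (List ℕ) := {σ ∈ T | ∀ τ ∈ T, σ <+: τ → τ = σ}

/-! ### Disjunctions -/

/-- The coproduct `(⟨0⟩ ⌢ P) ∪ (⟨1⟩ ⌢ Q)`. -/
def coproduct (P Q : Set Baire) : Set Baire := cat [0] '' P ∪ cat [1] '' Q

/-- The non-commutative concatenation of `P` and `Q` with respect to the tree `S` of `P`. -/
def ncConcat (S : Set (List ℕ)) (P Q : Set Baire) : Set Baire :=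
  P ∪ {f | ∃ ρ ∈ leaves S, ∃ g ∈ Q, f = cat ρ g}

/-- The commutative concatenation of `P` and `Q` with respect to the trees `S` of `P` and `T` of
`Q`. -/
def commConcat (S T : Set (List ℕ)) (P Q : Set Baire) : Set Baire :=
  coproduct (ncConcat S P Q) (ncConcat T Q P)

/-- The `i`-th projection of a record: the string written on tape `i`.  A symbol `⟨j, x⟩` of the
record is the instruction to write `x` on tape `j`. -/
def pr (i : ℕ) (σ : List ℕ) : List ℕ :=
  σ.filterMap fun p => if p.unpair.1 = i then some p.unpair.2 else none

/-- The `i`-th projection `⋃ₙ prᵢ(f ↾ n)` of the infinite record `f` is the infinite sequence `h`. -/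
def IsProj (i : ℕ) (f h : Baire) : Prop := ∀ m, ∃ n, res h m <+: pr i (res f n)

/-- The number of mind changes of the infinite record `f`. -/
noncomputable def mc (f : Baire) : ℕ∞ := {n | (f n).unpair.1 ≠ (f (n + 1)).unpair.1}.encard

/-- The infinite two-tape records with fewer than `n` mind changes (finitely many, if `n = ⊤`) that
write an element of `P` on tape `0` or an element of `Q` on tape `1`. -/
def lcmDisj (n : ℕ∞) (P Q : Set Baire) : Set Baire :=
  {f | (∀ k, (f k).unpair.1 < 2) ∧
    ((∃ h ∈ P, IsProj 0 f h) ∨ (∃ h ∈ Q, IsProj 1 f h)) ∧ mc f < n}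

/-- The consistency set of two trees: what is written on a tape stays in the tree of that tape. -/
def Con (S T : Set (List ℕ)) : Set Baire :=
  {f | (∀ k, (f k).unpair.1 < 2) ∧ ∀ n, pr 0 (res f n) ∈ S ∧ pr 1 (res f n) ∈ T}

/-- The consistent two-tape disjunction of `P` and `Q` with fewer than `n` mind changes (finitely
many, if `n = ⊤`), with respect to the trees `S` of `P` and `T` of `Q`. -/
def tie (n : ℕ∞) (S T : Set (List ℕ)) (P Q : Set Baire) : Set Baire := lcmDisj n P Q ∩ Con S T

end MassProblem

open MassProblem

namespace MassProblem

open Nat.Partrec (Code)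
open Encodable Denumerable

/-! ### Initial segments -/

/-! A finite injury construction yields `extensionClass 0` and `extensionClass 1`, together with
points `limitPoint i` of class `i` that compute no member of the other class
(`not_redTo_limitPoint`). A solver fed with a record built from these points is therefore forced to
notice on which tape the record keeps growing.

All three negative claims are instances of `not_below_of_isSwitching`. Take a record holding initial
segments of the two limit points and continue it forever on tape `i` by `limitPoint i`. This
informant is computable from `limitPoint i`, so the output computes no member of class `1 - i` and
must show evidence for `i`. As long as the learner keeps its guess, the evidence depends on a finite
part of the informant, after which the record may change its tape. Three rounds under one guess
would put evidence for 0, 1, 0 into a single output, which the targets exclude. So every three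
rounds force a mind change (`exists_change`), and no bound on mind changes survives. Evidence is the
tape last written on for `tie 2`, the class currently being followed for `commConcat`, and the first
bit for `budgetClass 0`.

For the reductions in part 1, `tie 2` is included in `tie ⊤`, and an element of `commConcat` is
rewritten as a record with at most one change of tape, at the leaf. Part 2 needs closed sets, so an
arbitrary finite number of tape changes is not available. Instead `budgetClass 1` bounds that number
by the position of the first change, while `budgetClass 0` allows none. Delaying the first change
leaves room for any prescribed number of switches. Still, every record settles on one tape, so
guessing the projection to the current tape succeeds with only two indices. -/

@[simp] theorem res_length (f : Baire) (n : ℕ) : (res f n).length = n := by simp [res]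

@[simp] theorem res_zero (f : Baire) : res f 0 = [] := rfl

@[simp] theorem getElem_res (f : Baire) (n k : ℕ) (h : k < (res f n).length) :
    (res f n)[k] = f k := by simp [res]

theorem getElem?_res (f : Baire) {n k : ℕ} (h : k < n) : (res f n)[k]? = some (f k) := by
  simp [res, h]

theorem res_succ (f : Baire) (n : ℕ) : res f (n + 1) = res f n ++ [f n] := by
  simp [res, List.range_succ]

theorem res_eq_res {f g : Baire} {n : ℕ} : res f n = res g n ↔ ∀ k < n, f k = g k := by
  simp [res]

theorem res_take (f : Baire) (m n : ℕ) : (res f n).take m = res f (min m n) := by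
  simp [res, ← List.map_take, List.take_range]

theorem res_prefix (f : Baire) {m n : ℕ} (h : m ≤ n) : res f m <+: res f n := by
  have := res_take f m n
  rw [min_eq_left h] at this
  rw [← this]
  exact List.take_prefix _ _

theorem res_eq_of_le {f g : Baire} {m n : ℕ} (h : m ≤ n) (H : res f n = res g n) :
    res f m = res g m :=
  res_eq_res.2 fun k hk => res_eq_res.1 H k (hk.trans_le h)

theorem mem_res {f : Baire} {n x : ℕ} : x ∈ res f n ↔ ∃ k < n, f k = x := by
  simp [res]

theorem eq_res_of_prefix {f : Baire} {n : ℕ} {σ : List ℕ} (h : σ <+: res f n) :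
    σ = res f σ.length := by
  have h1 := h.length_le
  rw [res_length] at h1
  have h2 := List.prefix_iff_eq_take.1 h
  rwa [res_take, min_eq_left h1] at h2

theorem cat_of_lt {σ : List ℕ} {f : Baire} {n : ℕ} (h : n < σ.length) : cat σ f n = σ[n] := by
  simp [cat, h]

@[simp] theorem cat_add (σ : List ℕ) (f : Baire) (n : ℕ) : cat σ f (σ.length + n) = f n := by
  simp [cat]

theorem cat_of_le {σ : List ℕ} {f : Baire} {n : ℕ} (h : σ.length ≤ n) :
    cat σ f n = f (n - σ.length) := by
  simp [cat, Nat.not_lt.2 h]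

@[simp] theorem cat_singleton_succ (a : ℕ) (f : Baire) (n : ℕ) : cat [a] f (n + 1) = f n := rfl

theorem res_cat_add (σ : List ℕ) (f : Baire) (n : ℕ) :
    res (cat σ f) (σ.length + n) = σ ++ res f n := by
  apply List.ext_getElem
  · simp
  · intro k h1 h2
    rw [getElem_res]
    by_cases hk : k < σ.length
    · rw [List.getElem_append_left hk, cat_of_lt hk]
    · rw [List.getElem_append_right (by omega), getElem_res, cat_of_le (by omega)]

@[simp] theorem res_cat_length (σ : List ℕ) (f : Baire) : res (cat σ f) σ.length = σ := by
  simpa using res_cat_add σ f 0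

/-! ### Turing functionals -/

/-- The search for the first nonzero answer of `r`. -/
def search (r : ℕ → Part ℕ) : Part ℕ :=
  (Nat.rfind fun s => (r s).map fun v => decide (v ≠ 0)).bind fun s => (r s).map Nat.pred

theorem mem_search {r : ℕ → Part ℕ} {v : ℕ} :
    v ∈ search r ↔ ∃ s, v + 1 ∈ r s ∧ ∀ t < s, 0 ∈ r t := by
  rw [search, Part.mem_bind_iff]
  constructor
  · rintro ⟨s, hs, hv⟩
    obtain ⟨h1, h2⟩ := Nat.mem_rfind.1 hs
    obtain ⟨a, ha, ha'⟩ := (Part.mem_map_iff _).1 h1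
    obtain ⟨b, hb, rfl⟩ := (Part.mem_map_iff _).1 hv
    obtain rfl := Part.mem_unique ha hb
    refine ⟨s, ?_, fun t ht => ?_⟩
    · have : a ≠ 0 := by simpa using ha'
      rwa [Nat.pred_eq_sub_one, Nat.sub_add_cancel (by omega)]
    · obtain ⟨b, hb, h'⟩ := (Part.mem_map_iff _).1 (h2 ht)
      have : b = 0 := by simpa using h'
      rwa [← this]
  · rintro ⟨s, h1, h2⟩
    exact ⟨s, Nat.mem_rfind.2 ⟨(Part.mem_map_iff _).2 ⟨_, h1, by simp⟩,
      fun {t} ht => (Part.mem_map_iff _).2 ⟨_, h2 t ht, by simp⟩⟩,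
      (Part.mem_map_iff _).2 ⟨_, h1, by simp⟩⟩

theorem mem_Phi {e : ℕ} {g : Baire} {n v : ℕ} :
    v ∈ Phi e g n ↔ ∃ s, v + 1 ∈ (ofNat Code e).eval (Nat.pair (encode (res g s)) n) ∧
      ∀ t < s, 0 ∈ (ofNat Code e).eval (Nat.pair (encode (res g t)) n) :=
  mem_search (r := fun s => (ofNat Code e).eval (Nat.pair (encode (res g s)) n))

theorem Phi_use {e : ℕ} {g : Baire} {n v : ℕ} (h : v ∈ Phi e g n) :
    ∃ u, ∀ g', res g' u = res g u → v ∈ Phi e g' n := by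
  obtain ⟨s, h1, h2⟩ := mem_Phi.1 h
  refine ⟨s, fun g' hg' => mem_Phi.2 ⟨s, by rwa [hg'], fun t ht => ?_⟩⟩
  rw [res_eq_of_le ht.le hg']
  exact h2 t ht

/-- Continuity: this is what lets evidence already shown survive a later change of the informant,
provided the guess stays the same. -/
theorem Computes.use {e : ℕ} {g h : Baire} (H : Computes e g h) (m : ℕ) :
    ∃ u, ∀ g' h', res g' u = res g u → Computes e g' h' → res h' m = res h m := by
  choose u hu using fun n => Phi_use (H n)
  refine ⟨(Finset.range m).sup u, fun g' h' hg H' => res_eq_res.2 fun k hk => ?_⟩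
  exact Part.mem_unique (H' k)
    (hu k g' (res_eq_of_le (Finset.le_sup (f := u) (Finset.mem_range.2 hk)) hg))

/-- A computable operator on initial segments is a Turing functional. -/
theorem exists_index {F : List ℕ → ℕ → Option ℕ} (hF : Computable₂ F) :
    ∃ e, ∀ g f : Baire, (∀ n, (∃ s, F (res g s) n = some (f n)) ∧
      ∀ s v, F (res g s) n = some v → v = f n) → Computes e g f := by
  -- Answers are shifted by one and `none` becomes `0`, as `Phi` reads `0` as a request for a longer
  -- oracle.
  have hc : Computable fun x : ℕ =>
      ((F (ofNat (List ℕ) x.unpair.1) x.unpair.2).map Nat.succ).getD 0 := by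
    refine Computable.option_getD (Computable.option_map (hF.comp
      ((Computable.ofNat (List ℕ)).comp (Computable.fst.comp Computable.unpair))
      (Computable.snd.comp Computable.unpair)) (Computable.succ.comp Computable.snd).to₂)
      (Computable.const 0)
  obtain ⟨c, hc⟩ := Code.exists_code.1 (Partrec.nat_iff.1 hc.partrec)
  have key : ∀ (g : Baire) (s n : ℕ), (ofNat Code (encode c)).eval
      (Nat.pair (encode (res g s)) n) = Part.some (((F (res g s) n).map Nat.succ).getD 0) := by
    intro g s n
    rw [ofNat_encode, hc]
    simp
  refine ⟨encode c, fun g f H n => mem_Phi.2 ?_⟩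
  obtain ⟨h1, h2⟩ := H n
  classical
  refine ⟨Nat.find h1, ?_, fun t ht => ?_⟩
  · rw [key, Nat.find_spec h1]
    simp
  · rw [key]
    have := Nat.find_min h1 ht
    cases hFt : F (res g t) n with
    | none => simp
    | some v => exact absurd (by rw [hFt, h2 t v hFt]) this

/-- `q` is computable from `f` by a partial recursive operator all of whose answers are correct. -/
def RedTo (q f : Baire) : Prop :=
  ∃ c : Code, ∀ n, (∃ t, q n ∈ c.eval (Nat.pair (encode (res f t)) n)) ∧
    ∀ t, ∀ v ∈ c.eval (Nat.pair (encode (res f t)) n), v = q n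

/-- `g` is obtained from `f` by a total computable transformation of initial segments. -/
def SimpleRed (g f : Baire) : Prop :=
  ∃ G : List ℕ → List ℕ, Computable G ∧ (∀ t, ∃ m, G (res f t) = res g m) ∧
    ∀ m, ∃ t, m ≤ (G (res f t)).length

/-- Each value of `q` is obtained computably from a single value of `h`. -/
def PointRed (q h : Baire) : Prop :=
  ∃ (K : ℕ → ℕ) (θ : ℕ → ℕ → ℕ), Computable K ∧ Computable₂ θ ∧ ∀ n, q n = θ n (h (K n))

/-- The run of the functional `e` on a finite oracle. -/
def runOn (e : ℕ) (τ : List ℕ) (m s : ℕ) : Part ℕ :=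
  Part.bind ↑(if s ≤ τ.length then some (Nat.pair (encode (τ.take s)) m) else none)
    fun x => (ofNat Code e).eval x

/-- The guard `s ≤ τ.length` makes runs beyond the end of the finite oracle diverge, so every answer
found comes from a genuine initial segment. This is the soundness needed in `RedTo`. -/
theorem mem_runOn_res {e m s v t : ℕ} {g : Baire} :
    v ∈ runOn e (res g t) m s ↔ s ≤ t ∧
      v ∈ (ofNat Code e).eval (Nat.pair (encode (res g s)) m) := by
  rw [runOn, res_length]
  split_ifs with h
  · rw [res_take, min_eq_left h, Part.coe_some, Part.bind_some]
    simp [h]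
  · rw [Part.coe_none, Part.bind_none]
    simp [h]

theorem partrec_runOn (e : ℕ) :
    Partrec fun a : (List ℕ × ℕ) × ℕ => runOn e a.1.1 a.1.2 a.2 := by
  have h1 : Primrec fun a : (List ℕ × ℕ) × ℕ => if a.2 ≤ a.1.1.length then
      some (Nat.pair (encode (a.1.1.take a.2)) a.1.2) else none := by
    refine Primrec.ite (Primrec.nat_le.comp Primrec.snd
      (Primrec.list_length.comp (Primrec.fst.comp Primrec.fst))) ?_ (Primrec.const none)
    exact Primrec.option_some.comp (Primrec₂.natPair.comp (Primrec.encode.comp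
      (Primrec.list_take.comp Primrec.snd (Primrec.fst.comp Primrec.fst)))
      (Primrec.snd.comp Primrec.fst))
  refine Partrec.bind (Computable.ofOption h1.to_comp) ?_
  exact Code.eval_part.comp (Computable.const _) Computable.snd

/-- Since `SimpleRed` transforms finite oracles and `PointRed` asks for a single output value, one
search over `runOn` performs the whole composition. -/
theorem RedTo.of_computes {e : ℕ} {f g h q : Baire} (hg : SimpleRed g f) (H : Computes e g h)
    (hq : PointRed q h) : RedTo q f := by
  obtain ⟨G, hG, hG1, hG2⟩ := hg
  obtain ⟨K, θ, hK, hθ, hq⟩ := hq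
  let A : ℕ → Part ℕ := fun x =>
    let τ := G (ofNat (List ℕ) x.unpair.1)
    let m := K x.unpair.2
    (search (runOn e τ m)).map (θ x.unpair.2)
  have hA : Partrec A := by
    have hτ : Computable fun x : ℕ => (G (ofNat (List ℕ) x.unpair.1), K x.unpair.2) :=
      (hG.comp ((Computable.ofNat (List ℕ)).comp (Computable.fst.comp Computable.unpair))).pair
        (hK.comp (Computable.snd.comp Computable.unpair))
    have hr : Partrec₂ fun (x s : ℕ) =>
        runOn e (G (ofNat (List ℕ) x.unpair.1)) (K x.unpair.2) s :=
      (partrec_runOn e).comp ((hτ.comp Computable.fst).pair Computable.snd)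
    have hd : Primrec fun v : ℕ => decide (v ≠ 0) :=
      (PrimrecPred.not (Primrec.eq.comp Primrec.id (Primrec.const 0))).decide
    refine Partrec.map (Partrec.bind (Partrec.rfind
      (Partrec.map hr (hd.to_comp.comp Computable.snd).to₂)) (Partrec.map hr ?_)) ?_
    · exact (Computable.pred.comp Computable.snd).to₂
    · exact hθ.comp (Computable.snd.comp (Computable.unpair.comp Computable.fst)) Computable.snd
  obtain ⟨c, hc⟩ := Code.exists_code.1 (Partrec.nat_iff.1 hA)
  have key : ∀ t n v, v ∈ c.eval (Nat.pair (encode (res f t)) n) ↔ ∃ s w,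
      v = θ n w ∧ w + 1 ∈ runOn e (G (res f t)) (K n) s ∧
        ∀ s' < s, 0 ∈ runOn e (G (res f t)) (K n) s' := by
    intro t n v
    rw [hc]
    simp only [A, Nat.unpair_pair, ofNat_encode, Part.mem_map_iff, mem_search]
    constructor
    · rintro ⟨w, ⟨s, h1, h2⟩, rfl⟩
      exact ⟨s, w, rfl, h1, h2⟩
    · rintro ⟨s, w, rfl, h1, h2⟩
      exact ⟨w, ⟨s, h1, h2⟩, rfl⟩
  refine ⟨c, fun n => ⟨?_, fun t v hv => ?_⟩⟩
  · obtain ⟨s, h1, h2⟩ := mem_Phi.1 (H (K n))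
    obtain ⟨t, ht⟩ := hG2 s
    obtain ⟨m, hm⟩ := hG1 t
    rw [hm, res_length] at ht
    refine ⟨t, (key _ _ _).2 ⟨s, _, hq n, ?_⟩⟩
    rw [hm]
    exact ⟨mem_runOn_res.2 ⟨ht, h1⟩, fun s' hs' => mem_runOn_res.2 ⟨by omega, h2 s' hs'⟩⟩
  · obtain ⟨s, w, rfl, h1, h2⟩ := (key _ _ _).1 hv
    obtain ⟨m, hm⟩ := hG1 t
    rw [hm] at h1 h2
    rw [hq n, Part.mem_unique (H (K n)) (mem_Phi.2
      ⟨s, (mem_runOn_res.1 h1).2, fun t ht => (mem_runOn_res.1 (h2 t ht)).2⟩)]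

/-! ### Reductions -/

/-- The restriction to `D` of a choice function for a relation. -/
theorem exists_partial_choice {D R : Set Baire} {X : Baire → Baire → Prop}
    (H : ∀ g ∈ D, ∃ h ∈ R, X g h) :
    ∃ Γ : Baire →. Baire, Γ.Dom = D ∧ (∀ g, ∀ h ∈ Γ g, X g h) ∧ ∀ g ∈ D, ∃ h ∈ Γ g, h ∈ R := by
  choose φ h1 h2 using H
  refine ⟨fun g => ⟨g ∈ D, fun hg => φ g hg⟩, rfl, ?_, fun g hg => ⟨φ g hg, ⟨hg, rfl⟩, h1 g hg⟩⟩
  rintro g _ ⟨hg, rfl⟩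
  exact h2 g hg

theorem below_boundedErrors {R D : Set Baire} (Ψ : List ℕ → ℕ) (hΨ : Computable Ψ) (b : ℕ)
    (hb : ∀ g ∈ D, (indx Ψ g).encard ≤ b)
    (H : ∀ g ∈ D, ∃ h ∈ R, ∃ e, (∀ᶠ n in Filter.atTop, Ψ (res g n) = e) ∧ Computes e g h) :
    Below boundedErrors R D := by
  obtain ⟨Γ, h1, h2, h3⟩ := exists_partial_choice H
  exact ⟨Γ, ⟨Ψ, hΨ, h2, b, by rwa [h1]⟩, h3⟩

theorem below_boundedMindChanges_of_index {R D : Set Baire} (e : ℕ)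
    (H : ∀ g ∈ D, ∃ h ∈ R, Computes e g h) : Below boundedMindChanges R D := by
  obtain ⟨Γ, h1, h2, h3⟩ := exists_partial_choice H
  refine ⟨Γ, ⟨fun _ => e, Computable.const e, fun g f hf => ⟨e, by simp, h2 g f hf⟩, 0, ?_⟩, h3⟩
  intro g _
  simp [mcl]

theorem below_boundedErrors_of_index {R D : Set Baire} (e : ℕ)
    (H : ∀ g ∈ D, ∃ h ∈ R, Computes e g h) : Below boundedErrors R D := by
  refine below_boundedErrors (fun _ => e) (Computable.const e) 1 (fun g _ => ?_) fun g hg => ?_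
  · simp [indx]
  · obtain ⟨h, h1, h2⟩ := H g hg
    exact ⟨h, h1, e, by simp, h2⟩

theorem exists_identity_index : ∃ e, ∀ g : Baire, Computes e g g := by
  obtain ⟨e, he⟩ := exists_index (F := fun σ n => σ[n]?) Computable.list_getElem?
  refine ⟨e, fun g => he g g fun n => ⟨⟨n + 1, getElem?_res g (Nat.lt_succ_self n)⟩, ?_⟩⟩
  intro s v h
  obtain ⟨h1, h2⟩ := List.getElem?_eq_some_iff.1 h
  simpa using h2.symm

/-! ### Two Muchnik incomparable `Π⁰₁` classes -/

/-- An entry `(x, v, s)`: at stage `s`, the value at `x` was fixed to be `v`. -/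
abbrev Entry : Type := ℕ × ℕ × ℕ

/-- The number of the current witness of requirement `r`: it is changed whenever a requirement of
higher priority acts. -/
def fresh (L : List Entry) (r : ℕ) : ℕ :=
  L.foldr (fun a k => if a.1.unpair.1 < r then a.2.2 + 1 else k) 0

/-- The value fixed at `x`, if any. -/
def look (L : List Entry) (x : ℕ) : Option ℕ :=
  L.foldr (fun a o => if a.1 = x then some a.2.1 else o) none

/-- The current witness of requirement `r`. -/
def witness (L : List Entry) (r : ℕ) : ℕ := Nat.pair r (fresh L r)

/-- The extension by zero of the values fixed on side `i`. -/
def approx (i : ℕ) (L : List Entry) : Baire :=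
  fun x => if x.unpair.1 % 2 = i then (look L x).getD 0 else 0

/-- The answer, at stage `s`, to the question asked by the requirement treated at that stage. -/
def answer (s : ℕ) (L : List Entry) : Option ℕ :=
  Code.evaln s (ofNat Code (s.unpair.1 / 2))
    (Nat.pair (encode (res (approx (1 - s.unpair.1 % 2) L) s.unpair.2.unpair.1))
      (witness L s.unpair.1))

/-- The entry made at stage `s`, if any. -/
def newEntry (s : ℕ) (L : List Entry) : Option Entry :=
  if look L (witness L s.unpair.1) = none then
    (answer s L).map fun v => (witness L s.unpair.1, 1 - v, s)
  else none

/-- The entries made before stage `s`. -/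
def state (s : ℕ) : List Entry :=
  Nat.rec [] (fun s L => (newEntry s L).toList ++ L) s

/-! ### Computability of the construction -/

theorem primrecRel_forall_lt {α : Type*} [Primcodable α] {X : ℕ → α → Prop} (h : PrimrecRel X) :
    PrimrecRel fun (n : ℕ) (y : α) => ∀ x < n, X x y :=
  (h.forall_mem_list.comp (Primrec.list_range.comp Primrec.fst) Primrec.snd).of_eq (by simp)

theorem primrec_fresh : Primrec₂ fresh := by
  refine Primrec.list_foldr (h := fun (p : List Entry × ℕ) (b : Entry × ℕ) =>
    if b.1.1.unpair.1 < p.2 then b.1.2.2 + 1 else b.2) Primrec.fst (Primrec.const 0) ?_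
  refine Primrec.ite (Primrec.nat_lt.comp (Primrec.fst.comp (Primrec.unpair.comp
    (Primrec.fst.comp (Primrec.fst.comp Primrec.snd)))) (Primrec.snd.comp Primrec.fst)) ?_
    (Primrec.snd.comp Primrec.snd)
  exact Primrec.succ.comp (Primrec.snd.comp (Primrec.snd.comp (Primrec.fst.comp Primrec.snd)))

theorem primrec_look : Primrec₂ look := by
  refine Primrec.list_foldr (h := fun (p : List Entry × ℕ) (b : Entry × Option ℕ) =>
    if b.1.1 = p.2 then some b.1.2.1 else b.2) Primrec.fst (Primrec.const none) ?_
  refine Primrec.ite (Primrec.eq.comp (Primrec.fst.comp (Primrec.fst.comp Primrec.snd))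
    (Primrec.snd.comp Primrec.fst)) ?_ (Primrec.snd.comp Primrec.snd)
  exact Primrec.option_some.comp
    (Primrec.fst.comp (Primrec.snd.comp (Primrec.fst.comp Primrec.snd)))

theorem primrec_witness : Primrec₂ witness :=
  Primrec₂.natPair.comp Primrec.snd primrec_fresh

theorem primrec_approx : Primrec fun a : (ℕ × List Entry) × ℕ => approx a.1.1 a.1.2 a.2 := by
  refine Primrec.ite (Primrec.eq.comp (Primrec.nat_mod.comp (Primrec.fst.comp
    (Primrec.unpair.comp Primrec.snd)) (Primrec.const 2)) (Primrec.fst.comp Primrec.fst)) ?_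
    (Primrec.const 0)
  exact Primrec.option_getD.comp
    (primrec_look.comp (Primrec.snd.comp Primrec.fst) Primrec.snd) (Primrec.const 0)

theorem primrec_answer : Primrec₂ answer := by
  have hr : Primrec fun a : ℕ × List Entry => a.1.unpair.1 :=
    Primrec.fst.comp (Primrec.unpair.comp Primrec.fst)
  have ht : Primrec fun a : ℕ × List Entry => a.1.unpair.2.unpair.1 :=
    Primrec.fst.comp (Primrec.unpair.comp (Primrec.snd.comp (Primrec.unpair.comp Primrec.fst)))
  have hres : Primrec fun a : ℕ × List Entry =>
      res (approx (1 - a.1.unpair.1 % 2) a.2) a.1.unpair.2.unpair.1 := by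
    refine Primrec.list_map (Primrec.list_range.comp ht) ?_
    have hi : Primrec fun a : (ℕ × List Entry) × ℕ => 1 - a.1.1.unpair.1 % 2 :=
      Primrec.nat_sub.comp (Primrec.const 1)
        (Primrec.nat_mod.comp (hr.comp Primrec.fst) (Primrec.const 2))
    exact (primrec_approx.comp (Primrec.pair (Primrec.pair hi
      (Primrec.snd.comp Primrec.fst)) Primrec.snd)).to₂
  refine Code.primrec_evaln.comp (Primrec.pair (Primrec.pair Primrec.fst
    ((Primrec.ofNat Code).comp (Primrec.nat_div.comp hr (Primrec.const 2)))) ?_)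
  exact Primrec₂.natPair.comp (Primrec.encode.comp hres) (primrec_witness.comp Primrec.snd hr)

theorem primrec_newEntry : Primrec₂ newEntry := by
  have hw : Primrec fun a : ℕ × List Entry => witness a.2 a.1.unpair.1 :=
    primrec_witness.comp Primrec.snd (Primrec.fst.comp (Primrec.unpair.comp Primrec.fst))
  refine Primrec.ite (Primrec.eq.comp (primrec_look.comp Primrec.snd hw) (Primrec.const none)) ?_
    (Primrec.const none)
  refine Primrec.option_map primrec_answer ?_
  exact Primrec.pair (hw.comp Primrec.fst) (Primrec.pair
    (Primrec.nat_sub.comp (Primrec.const 1) Primrec.snd) (Primrec.fst.comp Primrec.fst))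

theorem primrec_state : Primrec state :=
  Primrec.nat_rec₁ [] (Primrec.list_append.comp
    (Primrec.optionToList.comp primrec_newEntry) Primrec.snd)

/-- Requirement `r` acts at stage `s`, on the answer `v`. -/
def Acts (s r v : ℕ) : Prop :=
  r = s.unpair.1 ∧ v ∈ answer s (state s) ∧ look (state s) (witness (state s) r) = none

/-! ### Action and injury of requirements -/

theorem Acts.state_succ {s r v : ℕ} (h : Acts s r v) :
    state (s + 1) = (witness (state s) r, 1 - v, s) :: state s := by
  obtain ⟨rfl, h1, h2⟩ := h
  change (newEntry s (state s)).toList ++ state s = _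
  rw [newEntry, if_pos h2, Option.mem_def.1 h1]
  rfl

theorem state_succ_eq_or_acts (s : ℕ) : state (s + 1) = state s ∨ ∃ r v, Acts s r v := by
  change (newEntry s (state s)).toList ++ state s = _ ∨ _
  by_cases h : look (state s) (witness (state s) s.unpair.1) = none
  · cases hv : answer s (state s) with
    | none => exact Or.inl (by simp [newEntry, hv])
    | some v => exact Or.inr ⟨_, v, rfl, hv, h⟩
  · exact Or.inl (by simp [newEntry, h])

@[simp] theorem look_cons (y v t : ℕ) (L : List Entry) (x : ℕ) :
    look ((y, v, t) :: L) x = if y = x then some v else look L x := rfl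

@[simp] theorem fresh_cons (y v t : ℕ) (L : List Entry) (r : ℕ) :
    fresh ((y, v, t) :: L) r = if y.unpair.1 < r then t + 1 else fresh L r := rfl

theorem fresh_state_le (s r : ℕ) : fresh (state s) r ≤ s := by
  induction s with
  | zero => exact le_rfl
  | succ s ih =>
    rcases state_succ_eq_or_acts s with h | ⟨r', v, h⟩
    · rw [h]; omega
    · rw [h.state_succ, fresh_cons]
      split_ifs <;> omega

/-- An action at stage `s` resets the bound to `s + 1`, above every earlier bound by
`fresh_state_le`. -/
theorem fresh_state_mono {s s' : ℕ} (h : s ≤ s') (r : ℕ) :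
    fresh (state s) r ≤ fresh (state s') r := by
  induction s', h using Nat.le_induction with
  | base => exact le_rfl
  | succ s' _ ih =>
    rcases state_succ_eq_or_acts s' with h | ⟨r', v, h⟩
    · rwa [h]
    · have := fresh_state_le s' r
      rw [h.state_succ, fresh_cons]
      split_ifs <;> omega

theorem Acts.fresh_succ {s r v r' : ℕ} (h : Acts s r v) (hr : r < r') :
    fresh (state (s + 1)) r' = s + 1 := by
  rw [h.state_succ]
  simp [witness, hr]

theorem Acts.look_succ {s r v : ℕ} (h : Acts s r v) :
    look (state (s + 1)) (witness (state s) r) = some (1 - v) := by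
  rw [h.state_succ]
  simp

/-- Requirements act only on points that are still undecided, so a fixed value is never overwritten.
-/
theorem look_state_mono {s s' x v : ℕ} (h : s ≤ s') (hx : look (state s) x = some v) :
    look (state s') x = some v := by
  induction s', h using Nat.le_induction with
  | base => exact hx
  | succ s' _ ih =>
    rcases state_succ_eq_or_acts s' with h | ⟨r', v, h⟩
    · rwa [h]
    · rw [h.state_succ, look_cons, if_neg, ih]
      intro h'
      have := h.2.2
      rw [h', ih] at this
      cases this

theorem exists_acts_of_look {s s' x w : ℕ} (h : s ≤ s') (h1 : look (state s) x = none)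
    (h2 : look (state s') x = some w) :
    ∃ t ≥ s, ∃ r v, Acts t r v ∧ x = witness (state t) r ∧ w = 1 - v := by
  induction s', h using Nat.le_induction with
  | base => rw [h1] at h2; cases h2
  | succ s' hs ih =>
    rcases state_succ_eq_or_acts s' with h | ⟨r, v, h⟩
    · exact ih (by rwa [h] at h2)
    · by_cases hx : witness (state s') r = x
      · refine ⟨s', hs, r, v, h, hx.symm, ?_⟩
        rw [← hx, h.look_succ] at h2
        exact (Option.some.inj h2).symm
      · rw [h.state_succ, look_cons, if_neg hx] at h2
        exact ih h2

theorem fresh_state_eq_of_quiet {s₀ r : ℕ} (h : ∀ s ≥ s₀, ∀ r' < r, ∀ v, ¬ Acts s r' v) {s : ℕ}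
    (hs : s₀ ≤ s) : fresh (state s) r = fresh (state s₀) r := by
  induction s, hs using Nat.le_induction with
  | base => rfl
  | succ s hs ih =>
    rcases state_succ_eq_or_acts s with h' | ⟨r', v, h'⟩
    · rwa [h']
    · rw [h'.state_succ, fresh_cons, if_neg, ih]
      intro hr
      exact h s hs r' (by simpa [witness] using hr) v h'

/-- Finite injury: once all higher priorities are quiet, the witness of `r` no longer moves, and
after one action its value is fixed. Hence `r` acts at most once more. -/
theorem exists_quiet (r : ℕ) : ∃ s₀, ∀ s ≥ s₀, ∀ r' < r, ∀ v, ¬ Acts s r' v := by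
  induction r with
  | zero => exact ⟨0, fun s _ r' hr' => absurd hr' (Nat.not_lt_zero _)⟩
  | succ r ih =>
    obtain ⟨s₀, h₀⟩ := ih
    by_cases hex : ∃ s ≥ s₀, ∃ v, Acts s r v
    · obtain ⟨s₁, hs₁, v, h₁⟩ := hex
      refine ⟨s₁ + 1, fun s hs r' hr' v' h => ?_⟩
      rcases Nat.lt_succ_iff_lt_or_eq.1 hr' with hr' | rfl
      · exact h₀ s (by omega) r' hr' v' h
      · have e : witness (state s) r' = witness (state s₁) r' := by
          rw [witness, witness, fresh_state_eq_of_quiet h₀ (by omega),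
            fresh_state_eq_of_quiet h₀ hs₁]
        have := look_state_mono hs h₁.look_succ
        rw [← e, h.2.2] at this
        cases this
    · push Not at hex
      refine ⟨s₀, fun s hs r' hr' v h => ?_⟩
      rcases Nat.lt_succ_iff_lt_or_eq.1 hr' with hr' | rfl
      · exact h₀ s hs r' hr' v h
      · exact hex s hs v h

open Classical in
/-- The extension by zero of all values that are ever fixed on side `i`. -/
noncomputable def limitPoint (i : ℕ) : Baire :=
  fun x => if h : ∃ s v, look (state s) x = some v then approx i (state h.choose) x else 0

theorem limitPoint_eq_of_look {i s x v : ℕ} (hx : x.unpair.1 % 2 = i)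
    (h : look (state s) x = some v) : limitPoint i x = v := by
  have hex : ∃ s v, look (state s) x = some v := ⟨s, v, h⟩
  rw [limitPoint, dif_pos hex, approx, if_pos hx]
  obtain ⟨w, hw⟩ := hex.choose_spec
  have h1 := look_state_mono (le_max_left s hex.choose) h
  have h2 := look_state_mono (le_max_right s hex.choose) hw
  rw [hw]
  rw [h1] at h2
  simpa using h2.symm

theorem limitPoint_eq_approx {i s x : ℕ}
    (h : x.unpair.1 % 2 = i → ∀ s' v, look (state s') x = some v → look (state s) x = some v) :
    limitPoint i x = approx i (state s) x := by
  by_cases hx : x.unpair.1 % 2 = i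
  · by_cases hex : ∃ s v, look (state s) x = some v
    · obtain ⟨s', v, hv⟩ := hex
      rw [limitPoint_eq_of_look hx hv, approx, if_pos hx, h hx s' v hv, Option.getD_some]
    · rw [limitPoint, dif_neg hex, approx, if_pos hx]
      cases hl : look (state s) x with
      | none => rfl
      | some v => exact absurd ⟨s, v, hl⟩ hex
  · rw [limitPoint]
    simp [approx, hx]

theorem exists_res_approx_eq (i n : ℕ) :
    ∃ s₀, ∀ s ≥ s₀, res (approx i (state s)) n = res (limitPoint i) n := by
  have : ∀ x, ∃ s₀, ∀ s ≥ s₀, limitPoint i x = approx i (state s) x := by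
    intro x
    by_cases hex : ∃ s v, look (state s) x = some v
    · obtain ⟨s₀, v, hv⟩ := hex
      refine ⟨s₀, fun s hs => limitPoint_eq_approx fun _ s' v' h' => ?_⟩
      have h1 := look_state_mono (le_max_left s s') (look_state_mono hs hv)
      have h2 := look_state_mono (le_max_right s s') h'
      rw [← h2, h1]
      exact look_state_mono hs hv
    · exact ⟨0, fun s _ => limitPoint_eq_approx fun _ s' v' h' => absurd ⟨s', v', h'⟩ hex⟩
  choose u hu using this
  refine ⟨(Finset.range n).sup u, fun s hs => res_eq_res.2 fun k hk => (hu k s ?_).symm⟩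
  exact (Finset.le_sup (f := u) (Finset.mem_range.2 hk)).trans hs

/-- The `0`-`1`-valued total extensions of the values that are ever fixed on side `i`. -/
def extensionClass (i : ℕ) : Set Baire :=
  {g | (∀ n, g n < 2) ∧
    ∀ n, n.unpair.1 % 2 = i → ∀ s v, look (state s) n = some v → g n = v}

/-- The tree of the finite binary strings of length `s` that are compatible with the values fixed on
side `i` before stage `s`. -/
def extensionTree (i : ℕ) : Set (List ℕ) :=
  {σ | (∀ x ∈ σ, x < 2) ∧ ∀ n < σ.length, ¬ n.unpair.1 % 2 = i ∨
    look (state σ.length) n = none ∨ look (state σ.length) n = σ[n]?}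

/-- A string is tested only against the stage given by its length. A value fixed later is caught by
a longer initial segment, so the infinite paths respect all of them. -/
theorem isTreeFor_extensionTree (i : ℕ) : IsTreeFor (extensionTree i) (extensionClass i) where
  binary σ h := h.1
  prefix_closed σ τ hστ hτ := by
    refine ⟨fun x hx => hτ.1 x (hστ.subset hx), fun n hn => ?_⟩
    rcases hτ.2 n (hn.trans_le hστ.length_le) with h | h | h
    · exact Or.inl h
    · refine Or.inr (Or.inl ?_)
      cases hl : look (state σ.length) n with
      | none => rfl
      | some v => rw [look_state_mono hστ.length_le hl] at h; cases h
    · refine Or.inr ?_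
      cases hl : look (state σ.length) n with
      | none => exact Or.inl rfl
      | some v =>
        right
        rw [look_state_mono hστ.length_le hl] at h
        rw [h, List.getElem?_eq_getElem hn, hστ.getElem hn,
          List.getElem?_eq_getElem (hn.trans_le hστ.length_le)]
  computable := by
    have hl : Primrec fun a : ℕ × List ℕ => look (state a.2.length) a.1 :=
      primrec_look.comp (primrec_state.comp (Primrec.list_length.comp Primrec.snd)) Primrec.fst
    have h : PrimrecRel fun (n : ℕ) (σ : List ℕ) => ¬ n.unpair.1 % 2 = i ∨
        look (state σ.length) n = none ∨ look (state σ.length) n = σ[n]? := by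
      refine PrimrecPred.or (PrimrecPred.not (Primrec.eq.comp (Primrec.nat_mod.comp
        (Primrec.fst.comp (Primrec.unpair.comp Primrec.fst)) (Primrec.const 2))
        (Primrec.const i))) (PrimrecPred.or (Primrec.eq.comp hl (Primrec.const none))
        (Primrec.eq.comp hl (Primrec.list_getElem?.comp Primrec.snd Primrec.fst)))
    have h1 : PrimrecPred fun σ : List ℕ => ∀ x ∈ σ, x < 2 :=
      PrimrecPred.forall_mem_list (Primrec.nat_lt.comp Primrec.id (Primrec.const 2))
    have h2 := (primrecRel_forall_lt h).comp Primrec.list_length Primrec.id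
    exact (h1.and h2).computablePred
  paths_eq := by
    ext f
    constructor
    · intro hf
      have hget : ∀ {m n : ℕ}, n < m → (res f m)[n]? = some (f n) := getElem?_res f
      refine ⟨fun n => (hf (n + 1)).1 _ (mem_res.2 ⟨n, Nat.lt_succ_self n, rfl⟩), ?_⟩
      intro n hn s v hv
      have hl := look_state_mono (le_max_left s (n + 1)) hv
      have hlt : n < max s (n + 1) := lt_max_of_lt_right (Nat.lt_succ_self n)
      rcases (hf (max s (n + 1))).2 n (by simp) with h | h | h
      · exact absurd hn h
      · rw [res_length, hl] at h; cases h
      · rw [res_length, hl, hget hlt] at h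
        exact (Option.some.inj h).symm
    · rintro ⟨h1, h2⟩ m
      refine ⟨fun x hx => ?_, fun n hn => ?_⟩
      · obtain ⟨k, _, rfl⟩ := mem_res.1 hx
        exact h1 k
      · by_cases hi : n.unpair.1 % 2 = i
        · rw [res_length] at *
          refine Or.inr ?_
          cases hl : look (state m) n with
          | none => exact Or.inl rfl
          | some v => rw [getElem?_res f hn, h2 n hi m v hl]; exact Or.inr rfl
        · exact Or.inl hi

theorem limitPoint_mem (i : ℕ) : limitPoint i ∈ extensionClass i := by
  refine ⟨fun n => ?_, fun n hn s v h => limitPoint_eq_of_look hn h⟩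
  by_cases hn : n.unpair.1 % 2 = i
  · by_cases hex : ∃ s v, look (state s) n = some v
    · obtain ⟨s, v, hv⟩ := hex
      rw [limitPoint_eq_of_look hn hv]
      obtain ⟨t, _, r, v', _, _, rfl⟩ := exists_acts_of_look (Nat.zero_le s) rfl hv
      omega
    · rw [limitPoint, dif_neg hex]; omega
  · rw [limitPoint]
    simp [approx, hn]

/-- The diagonalization: the final witness of the requirement for `c` must be fixed, and its value
differs from the answer of `c`, which preservation of the oracle makes an answer about `limitPoint
i` itself. -/
theorem not_redTo_limitPoint {i : ℕ} (hi : i < 2) {q : Baire} (hq : q ∈ extensionClass (1 - i)) :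
    ¬ RedTo q (limitPoint i) := by
  rintro ⟨c, hc⟩
  -- Requirement `r` runs program `c` with oracle on side `i` and fixes values on side `1 - i`.
  obtain ⟨r, hr1, hr2⟩ : ∃ r, r % 2 = 1 - i ∧ r / 2 = encode c :=
    ⟨2 * encode c + (1 - i), by omega, by omega⟩
  have hri : 1 - r % 2 = i := by omega
  obtain ⟨s₀, h₀⟩ := exists_quiet r
  have hk : ∀ s ≥ s₀, witness (state s) r = witness (state s₀) r := fun s hs => by
    rw [witness, witness, fresh_state_eq_of_quiet h₀ hs]
  obtain ⟨x, hx⟩ : ∃ x, x = witness (state s₀) r := ⟨_, rfl⟩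
  have hxr : x.unpair = (r, fresh (state s₀) r) := by rw [hx, witness, Nat.unpair_pair]
  have hans : ∀ s L, s.unpair.1 = r → answer s L = Code.evaln s c (Nat.pair
      (encode (res (approx i L) s.unpair.2.unpair.1)) (witness L r)) := by
    intro s L hs
    rw [answer, hs, hr2, hri, ofNat_encode]
  by_cases hex : ∃ s w, look (state s) x = some w
  · obtain ⟨s, w, hw⟩ := hex
    have hqx : q x = w := hq.2 x (by rw [hxr]; exact hr1) s w hw
    obtain ⟨s₁, -, r', v, hact, hxw, rfl⟩ := exists_acts_of_look (Nat.zero_le s) rfl hw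
    have hxr' : x.unpair = (r', fresh (state s₁) r') := by rw [hxw, witness, Nat.unpair_pair]
    obtain ⟨rfl, hfr⟩ : r = r' ∧ fresh (state s₀) r = fresh (state s₁) r' := by
      rw [hxr] at hxr'
      simpa using hxr'
    have hv := hact.2.1
    rw [hans s₁ _ hact.1.symm] at hv
    have ht : s₁.unpair.2.unpair.1 ≤ s₁ :=
      (Nat.unpair_left_le _).trans (Nat.unpair_right_le _)
    have hres : res (approx i (state s₁)) s₁.unpair.2.unpair.1 =
        res (limitPoint i) s₁.unpair.2.unpair.1 := by
      refine res_eq_res.2 fun y hy => (limitPoint_eq_approx fun hyi s' w' hw' => ?_).symm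
      by_contra hne
      have hnone : look (state s₁) y = none := by
        cases hl : look (state s₁) y with
        | none => rfl
        | some w =>
          have h1 := look_state_mono (le_max_left s₁ s') hl
          have h2 := look_state_mono (le_max_right s₁ s') hw'
          rw [hl, ← h1, h2] at hne
          exact absurd rfl hne
      obtain ⟨s₂, hs₂, r₂, v₂, hact₂, rfl, -⟩ := exists_acts_of_look
        (le_max_left s₁ s') hnone (look_state_mono (le_max_right s₁ s') hw')
      have hr₂i : r₂ % 2 = i := by simpa [witness] using hyi
      have hle : fresh (state s₂) r₂ < s₁ :=
        (Nat.right_le_pair _ _).trans_lt (hy.trans_le ht)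
      -- Who could spoil the oracle at `y`? A higher priority would have moved the witness of `r`,
      -- which is already final. The index `r` itself has the wrong parity. A lower priority has a
      -- witness above `s₁`, beyond the part of the oracle used.
      rcases lt_trichotomy r₂ r with hlt | rfl | hlt
      · have h1 := hact₂.fresh_succ hlt
        have h2 := fresh_state_mono (le_max_left (s₂ + 1) s₀) r
        rw [fresh_state_eq_of_quiet h₀ (le_max_right _ _), hfr, h1] at h2
        have h3 := fresh_state_le s₁ r
        omega
      · omega
      · have hs : s₁ ≠ s₂ := by
          rintro rfl
          exact hlt.ne (hact.1.trans hact₂.1.symm)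
        have h1 := fresh_state_mono (show s₁ + 1 ≤ s₂ by omega) r₂
        rw [hact.fresh_succ hlt] at h1
        omega
    rw [hres] at hv
    have h := (hc _).2 _ v (Code.evaln_sound hv)
    -- Now `1 - v = v`, which no natural number satisfies.
    rw [← hxw, hqx] at h
    omega
  · push Not at hex
    obtain ⟨t, ht⟩ := (hc x).1
    obtain ⟨m, hm⟩ := Code.evaln_complete.1 ht
    obtain ⟨s₁, hs₁⟩ := exists_res_approx_eq i t
    -- Padding by `M` gives a stage devoted to `r` with oracle length `t`, late enough for the
    -- witness, the running time and the oracle to have settled.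
    let M := max s₀ (max m s₁)
    let s := Nat.pair r (Nat.pair t M)
    have hs : M ≤ s := (Nat.right_le_pair _ _).trans (Nat.right_le_pair _ _)
    have h0 : s₀ ≤ s := (le_max_left _ _).trans hs
    have h1 : m ≤ s := ((le_max_left _ _).trans (le_max_right _ _)).trans hs
    have h2 : s₁ ≤ s := ((le_max_right _ _).trans (le_max_right _ _)).trans hs
    have hsr : s.unpair.1 = r := by simp [s]
    have hst : s.unpair.2.unpair.1 = t := by simp [s]
    have hact : Acts s r (q x) := by
      refine ⟨hsr.symm, ?_, ?_⟩
      · rw [hans s _ hsr, hst, hs₁ s h2, hk s h0, ← hx]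
        exact Code.evaln_mono h1 hm
      · rw [hk s h0, ← hx]
        exact Option.eq_none_iff_forall_ne_some.2 (hex s)
    have := hact.look_succ
    rw [hk s h0, ← hx] at this
    exact hex _ _ this

/-! ### A criterion for the failure of learnability with bounded mind changes -/

/-- The learner `Ψ` changes its mind along `ρ` at `n`. -/
def ChangesAt (Ψ : List ℕ → ℕ) (ρ : List ℕ) (n : ℕ) : Prop :=
  n < ρ.length ∧ Ψ (ρ.take (n + 1)) ≠ Ψ (ρ.take n)

theorem changesAt_res {Ψ : List ℕ → ℕ} {g : Baire} {m n : ℕ} :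
    ChangesAt Ψ (res g m) n ↔ n < m ∧ n ∈ mcl Ψ g := by
  rw [ChangesAt, res_length]
  refine and_congr_right fun h => ?_
  rw [res_take, res_take, min_eq_left h.le, min_eq_left h]
  rfl

theorem ChangesAt.mono {Ψ : List ℕ → ℕ} {ρ ρ' : List ℕ} {n : ℕ} (h : ChangesAt Ψ ρ n)
    (hρ : ρ <+: ρ') : ChangesAt Ψ ρ' n := by
  obtain ⟨τ, rfl⟩ := hρ
  obtain ⟨h1, h2⟩ := h
  refine ⟨by rw [List.length_append]; omega, ?_⟩
  rwa [List.take_append_of_le_length h1, List.take_append_of_le_length h1.le]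

/-- A record `ρ` at a node with `N` remaining switches can be continued, for each `i`, to an element
of `D` that is computable from `limitPoint i` and along which nodes with `N - 1` remaining switches
are met again and again. -/
structure IsSwitching (D : Set Baire) (Node : ℕ → List ℕ → Prop) : Prop where
  anti : ∀ N ρ, Node (N + 1) ρ → Node N ρ
  init : ∀ N, ∃ ρ, Node N ρ
  ext : ∀ N ρ, Node (N + 1) ρ → ∀ i < 2, ∃ g ∈ D, SimpleRed g (limitPoint i) ∧
    res g ρ.length = ρ ∧ ∀ m, ∃ m' ≥ m, Node N (res g m')

/-- Evidence for the two alternatives that every element of `R` decides between: an element of `R`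
that computes no element of `extensionClass (1 - i)` provides evidence for `i` again and again, and no
element of `R` changes its evidence twice. -/
structure IsEvidence (R : Set Baire) (U : ℕ → List ℕ → Prop) : Prop where
  frequently : ∀ i < 2, ∀ h ∈ R, (∀ q ∈ extensionClass (1 - i), ¬ PointRed q h) →
    ∀ m₀, ∃ m > m₀, U i (res h m)
  no_return : ∀ h ∈ R, ∀ m₀ m₁ m₂, m₀ < m₁ → m₁ < m₂ → U 0 (res h m₀) → U 1 (res h m₁) →
    ¬ U 0 (res h m₂)

/-- Continue `ρ` towards `limitPoint i`. If the learner never changes its mind on this continuation,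
its present guess is the limit guess, so the output is computed by it and must show evidence for
`i`. The new node is taken past the use of that evidence. -/
theorem exists_change_or_evidence {R D : Set Baire} {U : ℕ → List ℕ → Prop}
    {Node : ℕ → List ℕ → Prop} (hU : IsEvidence R U) (hN : IsSwitching D Node) {Ψ : List ℕ → ℕ}
    (H : ∀ g ∈ D, ∃ h ∈ R, ∃ e, (∀ᶠ n in Filter.atTop, Ψ (res g n) = e) ∧ Computes e g h)
    {N i : ℕ} {ρ : List ℕ} (hρ : Node (N + 1) ρ) (hi : i < 2) (m₀ : ℕ) :
    ∃ ρ', ρ <+: ρ' ∧ Node N ρ' ∧ ((∃ n ≥ ρ.length, ChangesAt Ψ ρ' n) ∨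
      Ψ ρ' = Ψ ρ ∧ ∃ g, ∃ h ∈ R, ∃ m > m₀, res g ρ.length = ρ ∧ Computes (Ψ ρ) g h ∧
        U i (res h m) ∧
        ∀ g' h', res g' ρ'.length = ρ' → Computes (Ψ ρ) g' h' → res h' m = res h m) := by
  obtain ⟨g, hgD, hg, hgρ, hext⟩ := hN.ext N ρ hρ i hi
  have hpre : ∀ {m}, ρ.length ≤ m → ρ <+: res g m := fun h => by
    have := res_prefix g h
    rwa [hgρ] at this
  by_cases hch : ∃ n ≥ ρ.length, n ∈ mcl Ψ g
  · obtain ⟨n, hn, hn'⟩ := hch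
    obtain ⟨m, hm, hnode⟩ := hext (n + 1)
    exact ⟨res g m, hpre (by omega), hnode, Or.inl ⟨n, hn, changesAt_res.2 ⟨by omega, hn'⟩⟩⟩
  · have hconst : ∀ n ≥ ρ.length, Ψ (res g n) = Ψ ρ := by
      intro n hn
      induction n, hn using Nat.le_induction with
      | base => rw [hgρ]
      | succ n hn ih =>
        rw [← ih]
        by_contra hne
        exact hch ⟨n, hn, hne⟩
    obtain ⟨h, hR, e, he, hcomp⟩ := H g hgD
    obtain rfl : Ψ ρ = e := by
      obtain ⟨n, hn⟩ := Filter.eventually_atTop.1 he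
      rw [← hn _ (le_max_left n ρ.length), hconst _ (le_max_right _ _)]
    obtain ⟨m, hm, hUm⟩ := hU.frequently i hi h hR
      (fun q hq hqh => not_redTo_limitPoint hi hq (RedTo.of_computes hg hcomp hqh)) m₀
    obtain ⟨u, hu⟩ := hcomp.use m
    obtain ⟨m', hm', hnode⟩ := hext (max u ρ.length)
    have h1 : ρ.length ≤ m' := (le_max_right _ _).trans hm'
    have h2 : u ≤ m' := (le_max_left _ _).trans hm'
    refine ⟨res g m', hpre h1, hnode, Or.inr ⟨hconst _ h1, g, h, hR, m, hm, hgρ, hcomp, hUm, ?_⟩⟩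
    intro g' h' hg' hc'
    rw [res_length] at hg'
    exact hu g' h' (res_eq_of_le h2 hg') hc'

/-- Three rounds, for 0, 1 and 0, each placing its evidence beyond the previous one. If no round
produced a mind change, the last output would carry all three pieces of evidence. -/
theorem exists_change {R D : Set Baire} {U : ℕ → List ℕ → Prop}
    {Node : ℕ → List ℕ → Prop} (hU : IsEvidence R U) (hN : IsSwitching D Node) {Ψ : List ℕ → ℕ}
    (H : ∀ g ∈ D, ∃ h ∈ R, ∃ e, (∀ᶠ n in Filter.atTop, Ψ (res g n) = e) ∧ Computes e g h)
    {N : ℕ} {ρ : List ℕ} (hρ : Node (N + 3) ρ) :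
    ∃ ρ', ρ <+: ρ' ∧ Node N ρ' ∧ ∃ n ≥ ρ.length, ChangesAt Ψ ρ' n := by
  obtain ⟨ρ₀, hp₀, hn₀, ⟨n, hn, hch⟩ | ⟨he₀, -, h₀, -, m₀, -, -, -, hU₀, huse₀⟩⟩ :=
    exists_change_or_evidence hU hN H hρ (i := 0) (by omega) 0
  · exact ⟨ρ₀, hp₀, hN.anti _ _ (hN.anti _ _ hn₀), n, hn, hch⟩
  obtain ⟨ρ₁, hp₁, hn₁, ⟨n, hn, hch⟩ | ⟨he₁, -, h₁, -, m₁, hm₁, -, -, hU₁, huse₁⟩⟩ :=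
    exists_change_or_evidence hU hN H hn₀ (i := 1) (by omega) m₀
  · exact ⟨ρ₁, hp₀.trans hp₁, hN.anti _ _ hn₁, n, hp₀.length_le.trans hn, hch⟩
  obtain ⟨ρ₂, hp₂, hn₂, ⟨n, hn, hch⟩ | ⟨-, g, h₂, hR, m₂, hm₂, hg, hc, hU₂, -⟩⟩ :=
    exists_change_or_evidence hU hN H hn₁ (i := 0) (by omega) m₁
  · exact ⟨ρ₂, (hp₀.trans hp₁).trans hp₂, hn₂, n, (hp₀.trans hp₁).length_le.trans hn, hch⟩
  have hg₀ : res g ρ₀.length = ρ₀ := by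
    rw [← hg] at hp₁
    exact (eq_res_of_prefix hp₁).symm
  rw [he₁, he₀] at hc
  rw [he₀] at huse₁
  -- The third informant extends both earlier nodes and is read with the same guess, so `h₂` agrees
  -- with `h₀` up to `m₀` and with `h₁` up to `m₁`.
  have e₀ := huse₀ g h₂ hg₀ hc
  have e₁ := huse₁ g h₂ hg hc
  rw [← e₀] at hU₀
  rw [← e₁] at hU₁
  exact absurd hU₂ (hU.no_return h₂ hR m₀ m₁ m₂ hm₁ hm₂ hU₀ hU₁)

theorem not_below_of_isSwitching {R D : Set Baire} {U : ℕ → List ℕ → Prop}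
    {Node : ℕ → List ℕ → Prop} (hU : IsEvidence R U) (hN : IsSwitching D Node) :
    ¬ Below boundedMindChanges R D := by
  rintro ⟨Γ, ⟨Ψ, -, hid, b, hb⟩, hΓ⟩
  have H : ∀ g ∈ D, ∃ h ∈ R, ∃ e, (∀ᶠ n in Filter.atTop, Ψ (res g n) = e) ∧ Computes e g h := by
    intro g hg
    obtain ⟨h, h1, h2⟩ := hΓ g hg
    exact ⟨h, h2, hid g h h1⟩
  have key : ∀ j N, ∃ ρ, Node N ρ ∧ ∃ F : Finset ℕ, F.card = j ∧ ∀ n ∈ F, ChangesAt Ψ ρ n := by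
    intro j
    induction j with
    | zero =>
      intro N
      obtain ⟨ρ, hρ⟩ := hN.init N
      exact ⟨ρ, hρ, ∅, rfl, by simp⟩
    | succ j ih =>
      intro N
      obtain ⟨ρ, hρ, F, hF, hch⟩ := ih (N + 3)
      obtain ⟨ρ', hp, hn, n, hle, hn'⟩ := exists_change hU hN H hρ
      have hnF : n ∉ F := fun h => by
        have := (hch n h).1
        omega
      refine ⟨ρ', hn, insert n F, by rw [Finset.card_insert_of_notMem hnF, hF], fun k hk => ?_⟩
      rcases Finset.mem_insert.1 hk with rfl | hk
      · exact hn'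
      · exact (hch k hk).mono hp
  -- One switch is kept in reserve to continue the node to an element of `D`.
  obtain ⟨ρ, hρ, F, hF, hch⟩ := key (b + 1) 1
  obtain ⟨g, hgD, -, hgρ, -⟩ := hN.ext 0 ρ hρ 0 (by omega)
  have hsub : (F : Set ℕ) ⊆ mcl Ψ g := by
    intro n hn
    have := hch n hn
    rw [← hgρ] at this
    exact (changesAt_res.1 this).2
  obtain ⟨h, hh, -⟩ := hΓ g hgD
  have h1 := (Set.encard_le_encard hsub).trans (hb g (Part.dom_iff_mem.2 ⟨h, hh⟩))
  rw [Set.encard_coe_eq_coe_finsetCard, hF, Nat.cast_le] at h1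
  omega

/-! ### Records -/

theorem pr_append (i : ℕ) (σ τ : List ℕ) : pr i (σ ++ τ) = pr i σ ++ pr i τ :=
  List.filterMap_append

theorem pr_mono {σ τ : List ℕ} (h : σ <+: τ) (i : ℕ) : pr i σ <+: pr i τ := by
  obtain ⟨ρ, rfl⟩ := h
  rw [pr_append]
  exact List.prefix_append _ _

theorem pr_res_succ (i : ℕ) (f : Baire) (n : ℕ) : pr i (res f (n + 1)) =
    pr i (res f n) ++ if (f n).unpair.1 = i then [(f n).unpair.2] else [] := by
  rw [res_succ, pr_append]
  by_cases h : (f n).unpair.1 = i <;> simp [pr, h]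

theorem pr_map_pair_self (i : ℕ) (σ : List ℕ) : pr i (σ.map (Nat.pair i)) = σ := by
  induction σ with
  | nil => rfl
  | cons a σ ih => simp [pr]

theorem pr_map_pair_of_ne {i j : ℕ} (h : i ≠ j) (σ : List ℕ) : pr j (σ.map (Nat.pair i)) = [] := by
  induction σ with
  | nil => rfl
  | cons a σ ih => simp [pr, h]

/-- The record `ρ`, followed by `g` written on tape `b`. -/
def writeOn (ρ : List ℕ) (b : ℕ) (g : Baire) : Baire := cat ρ fun n => Nat.pair b (g n)

theorem res_writeOn (ρ : List ℕ) (b : ℕ) (g : Baire) (n : ℕ) :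
    res (writeOn ρ b g) (ρ.length + n) = ρ ++ (res g n).map (Nat.pair b) := by
  rw [writeOn, res_cat_add]
  simp [res]

theorem pr_res_writeOn (ρ : List ℕ) (b : ℕ) (g : Baire) (n : ℕ) :
    pr b (res (writeOn ρ b g) (ρ.length + n)) =
      res (cat (pr b ρ) g) ((pr b ρ).length + n) := by
  rw [res_writeOn, pr_append, pr_map_pair_self, res_cat_add]

theorem pr_res_writeOn_of_ne (ρ : List ℕ) {b j : ℕ} (h : b ≠ j) (g : Baire) (n : ℕ) :
    pr j (res (writeOn ρ b g) (ρ.length + n)) = pr j ρ := by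
  rw [res_writeOn, pr_append, pr_map_pair_of_ne h, List.append_nil]

theorem isProj_writeOn (ρ : List ℕ) (b : ℕ) (g : Baire) :
    IsProj b (writeOn ρ b g) (cat (pr b ρ) g) := fun m =>
  ⟨ρ.length + m, by rw [pr_res_writeOn]; exact res_prefix _ (by omega)⟩

theorem writeOn_tape_of_le {ρ : List ℕ} {b : ℕ} {g : Baire} {n : ℕ} (h : ρ.length ≤ n) :
    (writeOn ρ b g n).unpair.1 = b := by
  rw [writeOn, cat_of_le h, Nat.unpair_pair]

theorem writeOn_tape_lt {ρ : List ℕ} {b : ℕ} {g : Baire} (hρ : ∀ p ∈ ρ, p.unpair.1 < 2)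
    (hb : b < 2) (n : ℕ) : (writeOn ρ b g n).unpair.1 < 2 := by
  by_cases h : n < ρ.length
  · rw [writeOn, cat_of_lt h]
    exact hρ _ (List.getElem_mem h)
  · rwa [writeOn_tape_of_le (not_lt.1 h)]

theorem mc_writeOn_lt_top (ρ : List ℕ) (b : ℕ) (g : Baire) : mc (writeOn ρ b g) < ⊤ := by
  refine Set.encard_lt_top_iff.2 ((Set.finite_lt_nat ρ.length).subset fun n hn => ?_)
  by_contra h
  have h : ρ.length ≤ n := not_lt.1 h
  exact hn (by rw [writeOn_tape_of_le h, writeOn_tape_of_le (by omega)])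

theorem IsProj.pr_eq {i : ℕ} {f h : Baire} (H : IsProj i f h) (n : ℕ) :
    pr i (res f n) = res h (pr i (res f n)).length := by
  obtain ⟨m, hm⟩ := H (pr i (res f n)).length
  have h1 := pr_mono (res_prefix f (le_max_left n m)) i
  have h2 := hm.trans (pr_mono (res_prefix f (le_max_right n m)) i)
  exact (List.prefix_of_prefix_length_le h1 h2 (by simp)).eq_of_length (by simp)

theorem IsProj.exists_tape_eq {i : ℕ} {f h : Baire} (H : IsProj i f h) (a : ℕ) :
    ∃ n ≥ a, (f n).unpair.1 = i := by
  by_contra! hne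
  have hconst : ∀ n ≥ a, pr i (res f n) = pr i (res f a) := by
    intro n hn
    induction n, hn using Nat.le_induction with
    | base => rfl
    | succ n hn ih => rw [pr_res_succ, if_neg (hne n hn), List.append_nil, ih]
  obtain ⟨m, hm⟩ := H ((pr i (res f a)).length + 1)
  have h1 := (hm.trans (pr_mono (res_prefix f (le_max_left m a)) i)).length_le
  rw [hconst _ (le_max_right m a), res_length] at h1
  omega

theorem exists_change_of_tape_ne {f : Baire} {a b : ℕ} (hab : a ≤ b)
    (h : (f a).unpair.1 ≠ (f b).unpair.1) :
    ∃ n, a ≤ n ∧ n < b ∧ (f n).unpair.1 ≠ (f (n + 1)).unpair.1 := by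
  induction b, hab using Nat.le_induction with
  | base => exact absurd rfl h
  | succ b hab ih =>
    by_cases hb : (f a).unpair.1 = (f b).unpair.1
    · exact ⟨b, hab, Nat.lt_succ_self b, by rwa [← hb]⟩
    · obtain ⟨n, h1, h2, h3⟩ := ih hb
      exact ⟨n, h1, by omega, h3⟩

theorem exists_tape_const_of_finite {f : Baire}
    (h : {n | (f n).unpair.1 ≠ (f (n + 1)).unpair.1}.Finite) :
    ∃ a, ∀ n ≥ a, (f n).unpair.1 = (f a).unpair.1 := by
  obtain ⟨c, hc⟩ := h.bddAbove
  refine ⟨c + 1, fun n hn => ?_⟩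
  by_contra hne
  obtain ⟨k, h1, -, h3⟩ := exists_change_of_tape_ne hn (Ne.symm hne)
  have := hc h3
  omega

/-- If the record `f` writes `h` on tape `i`, and only on this tape from position `a` on, then the
values of `h` can be read off pointwise from `f`. -/
theorem IsProj.pointRed {i a : ℕ} {f h : Baire} (H : IsProj i f h)
    (ha : ∀ n ≥ a, (f n).unpair.1 = i) : PointRed h f := by
  obtain ⟨ρ, hρ⟩ : ∃ ρ, ρ = pr i (res f a) := ⟨_, rfl⟩
  have hlen : ∀ n, (pr i (res f (a + n))).length = ρ.length + n := by
    intro n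
    induction n with
    | zero => rw [hρ]; rfl
    | succ n ih => rw [← add_assoc, pr_res_succ, if_pos (ha _ (by omega))]; simp [ih]; omega
  have hval : ∀ n, h (ρ.length + n) = (f (a + n)).unpair.2 := by
    intro n
    have h1 := H.pr_eq (a + n + 1)
    rw [show a + n + 1 = a + (n + 1) by rfl, hlen, ← add_assoc,
      ← add_assoc, pr_res_succ, res_succ h, if_pos (ha _ (by omega)), H.pr_eq (a + n), hlen] at h1
    simpa using (List.append_cancel_left h1).symm
  have hρ' : ρ = res h ρ.length := by
    rw [hρ]
    exact H.pr_eq a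
  -- The finitely many values in `ρ` are built into the second function; for them the inspected
  -- value of `f` is ignored.
  refine ⟨fun n => a + (n - ρ.length),
    fun n v => if n < ρ.length then ρ.getD n 0 else v.unpair.2, ?_, ?_, fun n => ?_⟩
  · exact (Primrec.nat_add.comp (Primrec.const a)
      (Primrec.nat_sub.comp Primrec.id (Primrec.const ρ.length))).to_comp
  · refine Primrec.to_comp (Primrec.ite (Primrec.nat_lt.comp Primrec.fst
      (Primrec.const ρ.length)) ?_ (Primrec.snd.comp (Primrec.unpair.comp Primrec.snd)))
    exact (Primrec.list_getD 0).comp (Primrec.const ρ) Primrec.fst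
  · dsimp only
    by_cases hn : n < ρ.length
    · rw [if_pos hn, hρ', List.getD_eq_getElem _ _ (by simpa using hn), getElem_res]
    · rw [if_neg hn, ← hval, Nat.add_sub_cancel' (not_lt.1 hn)]

/-! ### The two trees -/

/-- The tree `S` for `a = 0`, the tree `T` otherwise. -/
def pick (S T : Set (List ℕ)) (a : ℕ) : Set (List ℕ) := if a = 0 then S else T

theorem isTreeFor_pick {S T : Set (List ℕ)} (hS : IsTreeFor S (extensionClass 0))
    (hT : IsTreeFor T (extensionClass 1)) {a : ℕ} (ha : a < 2) :
    IsTreeFor (pick S T a) (extensionClass a) := by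
  interval_cases a
  · exact hS
  · exact hT

theorem mem_con_iff {S T : Set (List ℕ)} {f : Baire} : f ∈ Con S T ↔
    (∀ k, (f k).unpair.1 < 2) ∧ ∀ j < 2, ∀ n, pr j (res f n) ∈ pick S T j := by
  refine and_congr_right fun _ => ⟨fun h j hj n => ?_, fun h n => ?_⟩
  · interval_cases j
    · exact (h n).1
    · exact (h n).2
  · exact ⟨h 0 (by omega) n, h 1 (by omega) n⟩

theorem mem_tie_iff {n : ℕ∞} {S T : Set (List ℕ)} {f : Baire} :
    f ∈ tie n S T (extensionClass 0) (extensionClass 1) ↔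
      f ∈ Con S T ∧ mc f < n ∧ ∃ j < 2, ∃ h ∈ extensionClass j, IsProj j f h := by
  have : (∃ j < 2, ∃ h ∈ extensionClass j, IsProj j f h) ↔
      (∃ h ∈ extensionClass 0, IsProj 0 f h) ∨ (∃ h ∈ extensionClass 1, IsProj 1 f h) := by
    constructor
    · rintro ⟨j, hj, h⟩
      interval_cases j
      · exact Or.inl h
      · exact Or.inr h
    · rintro (h | h)
      · exact ⟨0, by omega, h⟩
      · exact ⟨1, by omega, h⟩
  rw [this]
  constructor
  · rintro ⟨⟨h1, h2, h3⟩, h4⟩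
    exact ⟨h4, h3, h2⟩
  · rintro ⟨h1, h2, h3⟩
    exact ⟨⟨h1.1, h3, h2⟩, h1⟩

theorem writeOn_mem_con {S T : Set (List ℕ)} (hS : IsTreeFor S (extensionClass 0))
    (hT : IsTreeFor T (extensionClass 1)) {ρ : List ℕ} (hρ : ∀ p ∈ ρ, p.unpair.1 < 2) {b : ℕ}
    (hb : b < 2) {g : Baire} (hg : cat (pr b ρ) g ∈ extensionClass b)
    (hρ' : pr (1 - b) ρ ∈ pick S T (1 - b)) : writeOn ρ b g ∈ Con S T := by
  refine mem_con_iff.2 ⟨writeOn_tape_lt hρ hb, fun j hj n => ?_⟩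
  have htree := isTreeFor_pick hS hT hj
  refine htree.prefix_closed _ _
    (pr_mono (res_prefix _ (show n ≤ ρ.length + n by omega)) j) ?_
  by_cases hjb : b = j
  · subst hjb
    rw [pr_res_writeOn]
    rw [← htree.paths_eq] at hg
    exact hg _
  · rw [pr_res_writeOn_of_ne ρ hjb]
    rwa [show 1 - b = j by omega] at hρ'

theorem writeOn_mem_tie_top {S T : Set (List ℕ)} (hS : IsTreeFor S (extensionClass 0))
    (hT : IsTreeFor T (extensionClass 1)) {ρ : List ℕ} (hρ : ∀ p ∈ ρ, p.unpair.1 < 2) {b : ℕ}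
    (hb : b < 2) {g : Baire} (hg : cat (pr b ρ) g ∈ extensionClass b)
    (hρ' : pr (1 - b) ρ ∈ pick S T (1 - b)) :
    writeOn ρ b g ∈ tie ⊤ S T (extensionClass 0) (extensionClass 1) :=
  mem_tie_iff.2 ⟨writeOn_mem_con hS hT hρ hb hg hρ', mc_writeOn_lt_top ρ b g, b, hb, _, hg,
    isProj_writeOn ρ b g⟩

/-! ### Records of initial segments of the limit points -/

/-- On both tapes of `ρ` there is an initial segment of the respective limit point. -/
def IsLimitRecord (ρ : List ℕ) : Prop :=
  (∀ p ∈ ρ, p.unpair.1 < 2) ∧ ∀ j < 2, pr j ρ = res (limitPoint j) (pr j ρ).length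

/-- The continuation of `ρ` by the remaining values of the `i`-th limit point, on tape `i`. -/
noncomputable def continueOn (i : ℕ) (ρ : List ℕ) : Baire :=
  writeOn ρ i fun n => limitPoint i ((pr i ρ).length + n)

theorem res_continueOn_length (i : ℕ) (ρ : List ℕ) : res (continueOn i ρ) ρ.length = ρ := by
  rw [continueOn, writeOn, res_cat_length]

theorem cat_res_tail (f : Baire) (n : ℕ) : cat (res f n) (fun k => f (n + k)) = f := by
  funext k
  by_cases hk : k < n
  · rw [cat_of_lt (by simpa using hk), getElem_res]
  · rw [cat_of_le (by simpa using hk), res_length, Nat.add_sub_cancel' (not_lt.1 hk)]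

namespace IsLimitRecord

variable {ρ : List ℕ} {i : ℕ} {S T : Set (List ℕ)}

theorem cat_tail (h : IsLimitRecord ρ) (hi : i < 2) :
    cat (pr i ρ) (fun n => limitPoint i ((pr i ρ).length + n)) = limitPoint i := by
  have := cat_res_tail (limitPoint i) (pr i ρ).length
  rwa [← h.2 i hi] at this

theorem pr_mem (h : IsLimitRecord ρ) (hS : IsTreeFor S (extensionClass 0))
    (hT : IsTreeFor T (extensionClass 1)) (hi : i < 2) : pr i ρ ∈ pick S T i := by
  rw [h.2 i hi]
  have := limitPoint_mem i
  rw [← (isTreeFor_pick hS hT hi).paths_eq] at this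
  exact this _

theorem continueOn_res (h : IsLimitRecord ρ) (hi : i < 2) (n : ℕ) :
    IsLimitRecord (res (continueOn i ρ) (ρ.length + n)) := by
  refine ⟨fun p hp => ?_, fun j hj => ?_⟩
  · obtain ⟨k, -, rfl⟩ := mem_res.1 hp
    exact writeOn_tape_lt h.1 hi k
  · by_cases hij : i = j
    · subst hij
      rw [continueOn, pr_res_writeOn, h.cat_tail hi, res_length]
    · rw [continueOn, pr_res_writeOn_of_ne ρ hij]
      exact h.2 j hj

theorem continueOn_mem_tie (h : IsLimitRecord ρ) (hS : IsTreeFor S (extensionClass 0))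
    (hT : IsTreeFor T (extensionClass 1)) (hi : i < 2) :
    continueOn i ρ ∈ tie ⊤ S T (extensionClass 0) (extensionClass 1) := by
  refine writeOn_mem_tie_top hS hT h.1 hi ?_ (h.pr_mem hS hT (by omega))
  rw [h.cat_tail hi]
  exact limitPoint_mem i

theorem simpleRed_continueOn (i : ℕ) (ρ : List ℕ) :
    SimpleRed (continueOn i ρ) (limitPoint i) := by
  have hG : ∀ t, ρ ++ ((res (limitPoint i) t).drop (pr i ρ).length).map (Nat.pair i) =
      res (continueOn i ρ) (ρ.length + (t - (pr i ρ).length)) := by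
    intro t
    rw [continueOn, res_writeOn]
    congr 2
    apply List.ext_getElem
    · simp
    · intro k h1 h2
      simp
  refine ⟨fun σ => ρ ++ (σ.drop (pr i ρ).length).map (Nat.pair i), ?_, fun t => ⟨_, hG t⟩,
    fun m => ⟨(pr i ρ).length + m, ?_⟩⟩
  · refine Primrec.to_comp (Primrec.list_append.comp (Primrec.const ρ) (Primrec.list_map
      (Primrec.list_drop.comp (Primrec.const _) Primrec.id) ?_))
    exact Primrec₂.natPair.comp (Primrec.const i) Primrec.snd
  · dsimp only
    rw [hG, res_length]
    omega

end IsLimitRecord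

/-- Only finiteness of the number of tape changes is demanded, so the counter of remaining switches
plays no role. -/
theorem isSwitching_tie {S T : Set (List ℕ)} (hS : IsTreeFor S (extensionClass 0))
    (hT : IsTreeFor T (extensionClass 1)) :
    IsSwitching (tie ⊤ S T (extensionClass 0) (extensionClass 1)) fun _ => IsLimitRecord where
  anti _ _ h := h
  init _ := ⟨[], by simp, fun _ _ => rfl⟩
  ext _ ρ h i hi := ⟨continueOn i ρ, h.continueOn_mem_tie hS hT hi,
    IsLimitRecord.simpleRed_continueOn i ρ, res_continueOn_length i ρ,
    fun m => ⟨ρ.length + m, by omega, h.continueOn_res hi m⟩⟩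

/-! ### The two targets of the first part -/

/-- Evidence is the tape last written on. Tapes 0, 1, 0 in turn need two changes, and a record that
settles on tape `1 - i` yields a member of that class pointwise. -/
theorem isEvidence_tie_two (S T : Set (List ℕ)) :
    IsEvidence (tie 2 S T (extensionClass 0) (extensionClass 1))
      fun i σ => σ.getLast?.map (fun p => p.unpair.1) = some i := by
  have hlast : ∀ (h : Baire) (i m : ℕ),
      (res h m).getLast?.map (fun p => p.unpair.1) = some i ↔
        ∃ k, m = k + 1 ∧ (h k).unpair.1 = i := by
    intro h i m
    cases m with
    | zero => simp
    | succ k => simp [res_succ]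
  refine ⟨fun i hi h hh hq m₀ => ?_, fun h hh m₀ m₁ m₂ h01 h12 hm₀ hm₁ hm₂ => ?_⟩
  · obtain ⟨-, hmc, j, hj, q, hqj, hproj⟩ := mem_tie_iff.1 hh
    obtain ⟨a, ha⟩ := exists_tape_const_of_finite (f := h)
      (Set.encard_lt_top_iff.1 (hmc.trans_le le_top))
    have hja : ∀ n ≥ a, (h n).unpair.1 = j := by
      obtain ⟨n, hn, hnj⟩ := hproj.exists_tape_eq a
      intro k hk
      rw [ha k hk, ← ha n hn, hnj]
    by_cases hij : j = i
    · exact ⟨max a m₀ + 1, by omega, (hlast _ _ _).2 ⟨_, rfl, by rw [hja _ (by omega), hij]⟩⟩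
    · rw [show j = 1 - i by omega] at hqj
      exact absurd (hproj.pointRed hja) (hq q hqj)
  · obtain ⟨k₀, rfl, t₀⟩ := (hlast _ _ _).1 hm₀
    obtain ⟨k₁, rfl, t₁⟩ := (hlast _ _ _).1 hm₁
    obtain ⟨k₂, rfl, t₂⟩ := (hlast _ _ _).1 hm₂
    obtain ⟨n, hn1, hn2, hn⟩ := exists_change_of_tape_ne (f := h) (show k₀ ≤ k₁ by omega)
      (by rw [t₀, t₁]; omega)
    obtain ⟨n', hn1', hn2', hn'⟩ := exists_change_of_tape_ne (f := h) (show k₁ ≤ k₂ by omega)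
      (by rw [t₁, t₂]; omega)
    have hsub : ({n, n'} : Set ℕ) ⊆ {n | (h n).unpair.1 ≠ (h (n + 1)).unpair.1} := by
      rintro k (rfl | rfl)
      · exact hn
      · exact hn'
    have := Set.encard_le_encard hsub
    rw [Set.encard_pair (by omega)] at this
    exact absurd (this.trans_lt (mem_tie_iff.1 hh).2.1) (lt_irrefl _)

theorem mem_commConcat_iff {S T : Set (List ℕ)} {h : Baire} :
    h ∈ commConcat S T (extensionClass 0) (extensionClass 1) ↔ ∃ a < 2,
      ∃ x ∈ ncConcat (pick S T a) (extensionClass a) (extensionClass (1 - a)), cat [a] x = h := by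
  constructor
  · rintro (⟨x, hx, rfl⟩ | ⟨x, hx, rfl⟩)
    · exact ⟨0, by omega, x, hx, rfl⟩
    · exact ⟨1, by omega, x, hx, rfl⟩
  · rintro ⟨a, ha, x, hx, rfl⟩
    interval_cases a
    · exact Or.inl ⟨x, hx, rfl⟩
    · exact Or.inr ⟨x, hx, rfl⟩

theorem res_cat_singleton (a : ℕ) (x : Baire) (m : ℕ) :
    res (cat [a] x) (m + 1) = a :: res x m := by
  rw [add_comm]
  exact res_cat_add [a] x m

/-- Nothing in the tree properly extends a leaf, so leaving the tree reveals exactly where `ρ` ends.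
-/
theorem res_cat_mem_iff_of_mem_leaves {S : Set (List ℕ)} {P : Set Baire} (hS : IsTreeFor S P)
    {ρ : List ℕ} (hρ : ρ ∈ leaves S) (g : Baire) (n : ℕ) :
    res (cat ρ g) n ∈ S ↔ n ≤ ρ.length := by
  constructor
  · intro h
    by_contra hn
    have hpre := res_prefix (cat ρ g) (not_le.1 hn).le
    rw [res_cat_length] at hpre
    have := congrArg List.length (hρ.2 _ h hpre)
    rw [res_length] at this
    omega
  · intro hn
    have hpre := res_prefix (cat ρ g) hn
    rw [res_cat_length] at hpre
    exact hS.prefix_closed _ _ hpre hρ.1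

theorem pointRed_of_eq_add {q h : Baire} (k : ℕ) (H : ∀ n, q n = h (n + k)) : PointRed q h :=
  ⟨fun n => n + k, fun _ v => v,
    (Primrec.nat_add.comp Primrec.id (Primrec.const k)).to_comp, Computable.snd, H⟩

/-- After the first bit `a`, the sequence appears to belong to class `a` while it is in the tree and
to class `1 - a` once it has left. Leaving the tree is irreversible, so this opinion changes at most
once. -/
theorem isEvidence_commConcat {S T : Set (List ℕ)} (hS : IsTreeFor S (extensionClass 0))
    (hT : IsTreeFor T (extensionClass 1)) :
    IsEvidence (commConcat S T (extensionClass 0) (extensionClass 1))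
      fun i σ => ∃ a τ, σ = a :: τ ∧ (a = i ↔ τ ∈ pick S T a) := by
  have hiff : ∀ (a i m : ℕ) (x : Baire),
      (∃ b τ, res (cat [a] x) m = b :: τ ∧ (b = i ↔ τ ∈ pick S T b)) ↔
        ∃ k, m = k + 1 ∧ (a = i ↔ res x k ∈ pick S T a) := by
    intro a i m x
    cases m with
    | zero => simp
    | succ k => simp [res_cat_singleton]
  refine ⟨fun i hi h hh hq m₀ => ?_, fun h hh m₀ m₁ m₂ h01 h12 hm₀ hm₁ hm₂ => ?_⟩
  · obtain ⟨a, ha, x, hx, rfl⟩ := mem_commConcat_iff.1 hh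
    have htree := isTreeFor_pick hS hT ha
    rcases hx with hx | ⟨ρ, hρ, g, hg, rfl⟩
    · by_cases hai : a = i
      · refine ⟨m₀ + 1, by omega, (hiff _ _ _ _).2 ⟨m₀, rfl, ?_⟩⟩
        rw [← htree.paths_eq] at hx
        exact iff_of_true hai (hx m₀)
      · have hx' : x ∈ extensionClass (1 - i) := by rwa [show 1 - i = a by omega]
        exact absurd (pointRed_of_eq_add (q := x) (h := cat [a] x) 1 fun _ => rfl)
          (hq x hx')
    · by_cases hai : a = i
      · rw [hai] at hg
        refine absurd (pointRed_of_eq_add (ρ.length + 1) fun n => ?_) (hq g hg)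
        rw [← add_assoc, cat_singleton_succ, add_comm, cat_add]
      · refine ⟨max m₀ (ρ.length + 1) + 1, by omega, (hiff _ _ _ _).2 ⟨_, rfl, ?_⟩⟩
        refine iff_of_false hai fun hmem => ?_
        have := (res_cat_mem_iff_of_mem_leaves htree hρ g _).1 hmem
        omega
  · obtain ⟨a, ha, x, hx, rfl⟩ := mem_commConcat_iff.1 hh
    obtain ⟨k₀, rfl, t₀⟩ := (hiff _ _ _ _).1 hm₀
    obtain ⟨k₁, rfl, t₁⟩ := (hiff _ _ _ _).1 hm₁
    obtain ⟨k₂, rfl, t₂⟩ := (hiff _ _ _ _).1 hm₂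
    have hmono := fun {k k' : ℕ} (hk : k ≤ k') =>
      (isTreeFor_pick hS hT ha).prefix_closed _ _ (res_prefix x hk)
    interval_cases a
    · have h1 := hmono (show k₁ ≤ k₂ by omega) (t₂.1 rfl)
      have := t₁.2 h1
      omega
    · have h1 := hmono (show k₀ ≤ k₁ by omega) (t₁.1 rfl)
      have := t₀.2 h1
      omega

/-! ### Reductions to the records with finitely many tape changes -/

theorem tie_mono (S T : Set (List ℕ)) (P Q : Set Baire) {m n : ℕ∞} (h : m ≤ n) :
    tie m S T P Q ⊆ tie n S T P Q := fun _ hf => ⟨⟨hf.1.1, hf.1.2.1, hf.1.2.2.trans_le h⟩, hf.2⟩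

theorem exists_record_of_mem_ncConcat {S T : Set (List ℕ)} (hS : IsTreeFor S (extensionClass 0))
    (hT : IsTreeFor T (extensionClass 1)) {a : ℕ} (ha : a < 2) {x y : Baire}
    (hx : x ∈ ncConcat (pick S T a) (extensionClass a) (extensionClass (1 - a)))
    (hy₁ : ∀ n, res x (n + 1) ∈ pick S T a → y n = Nat.pair a (x n))
    (hy₂ : ∀ n, res x (n + 1) ∉ pick S T a → y n = Nat.pair (1 - a) (x n)) :
    y ∈ tie ⊤ S T (extensionClass 0) (extensionClass 1) := by
  have htree := isTreeFor_pick hS hT ha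
  rcases hx with hx | ⟨ρ, hρ, g, hg, rfl⟩
  · have hp : x ∈ paths (pick S T a) := by rwa [htree.paths_eq]
    have : y = writeOn [] a x := funext fun n => hy₁ n (hp _)
    rw [this]
    refine writeOn_mem_tie_top hS hT (by simp) ha hx ?_
    have hb : 1 - a < 2 := by omega
    have := limitPoint_mem (1 - a)
    rw [← (isTreeFor_pick hS hT hb).paths_eq] at this
    exact this 0
  · have hmem := res_cat_mem_iff_of_mem_leaves htree hρ g
    have : y = writeOn (ρ.map (Nat.pair a)) (1 - a) g := by
      funext n
      by_cases hn : n < ρ.length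
      · rw [hy₁ n ((hmem _).2 hn), writeOn, cat_of_lt hn, cat_of_lt (by simpa using hn)]
        simp
      · rw [hy₂ n (fun h => hn ((hmem _).1 h)), writeOn, cat_of_le (not_lt.1 hn),
          cat_of_le (by simpa using hn)]
        simp
    rw [this]
    refine writeOn_mem_tie_top hS hT (by simpa using fun _ _ => ha) (by omega) ?_ ?_
    · rw [pr_map_pair_of_ne (by omega)]
      exact hg
    · rw [show 1 - (1 - a) = a by omega, pr_map_pair_self]
      exact hρ.1

theorem tie_below_commConcat {S T : Set (List ℕ)} (hS : IsTreeFor S (extensionClass 0))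
    (hT : IsTreeFor T (extensionClass 1)) :
    Below boundedMindChanges (tie ⊤ S T (extensionClass 0) (extensionClass 1))
      (commConcat S T (extensionClass 0) (extensionClass 1)) := by
  classical
  -- The tape of a symbol is decided by whether the string up to and including it is in the tree;
  -- trees are decidable, so a single index suffices.
  let tape : ℕ → List ℕ → ℕ := fun a τ => if τ ∈ pick S T a then a else 1 - a
  have htape : Computable₂ tape := by
    obtain ⟨_, hdS⟩ := hS.computable
    obtain ⟨_, hdT⟩ := hT.computable
    have hb : Primrec fun p : ℕ × List ℕ => decide (p.1 = 0) :=
      (Primrec.eq.comp Primrec.fst (Primrec.const 0)).decide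
    have hd : Computable fun p : ℕ × List ℕ =>
        bif decide (p.1 = 0) then decide (p.2 ∈ S) else decide (p.2 ∈ T) :=
      Computable.cond hb.to_comp (hdS.comp Computable.snd) (hdT.comp Computable.snd)
    refine (Computable.cond hd Computable.fst
      (Primrec.nat_sub.comp (Primrec.const 1) Primrec.fst).to_comp).of_eq fun p => ?_
    by_cases h0 : p.1 = 0 <;> simp [tape, pick, h0, Bool.cond_decide]
  have hF : Computable₂ fun (σ : List ℕ) (n : ℕ) => σ[n + 1]?.map fun v =>
      Nat.pair (tape σ.headI (σ.tail.take (n + 1))) v := by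
    refine Computable.option_map (Computable.list_getElem?.comp Computable.fst
      (Computable.succ.comp Computable.snd)) ?_
    refine Primrec₂.natPair.to_comp.comp (htape.comp
      (Primrec.list_headI.comp (Primrec.fst.comp Primrec.fst)).to_comp
      (Primrec.list_take.comp (Primrec.succ.comp (Primrec.snd.comp Primrec.fst))
        (Primrec.list_tail.comp (Primrec.fst.comp Primrec.fst))).to_comp) Computable.snd
  obtain ⟨e, he⟩ := exists_index hF
  refine below_boundedMindChanges_of_index e fun h hh => ?_
  obtain ⟨a, ha, x, hx, rfl⟩ := mem_commConcat_iff.1 hh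
  have hval : ∀ n s, n + 1 < s → ((res (cat [a] x) s)[n + 1]?.map fun v =>
      Nat.pair (tape (res (cat [a] x) s).headI ((res (cat [a] x) s).tail.take (n + 1))) v) =
        some (Nat.pair (tape a (res x (n + 1))) (x n)) := by
    intro n s hs
    obtain ⟨s, rfl⟩ : ∃ k, s = k + 1 := ⟨s - 1, by omega⟩
    rw [getElem?_res _ hs, res_cat_singleton, cat_singleton_succ, Option.map_some,
      List.headI_cons, List.tail_cons, res_take, min_eq_left (by omega)]
  refine ⟨fun n => Nat.pair (tape a (res x (n + 1))) (x n), ?_, he _ _ fun n =>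
    ⟨⟨n + 2, hval n _ (by omega)⟩, fun s v hv => ?_⟩⟩
  · refine exists_record_of_mem_ncConcat hS hT ha hx (fun n hn => ?_) fun n hn => ?_
    · simp only [tape, if_pos hn]
    · simp only [tape, if_neg hn]
  · by_cases hs : n + 1 < s
    · rw [hval n s hs] at hv
      exact (Option.some.inj hv).symm
    · rw [List.getElem?_eq_none (by simpa using hs)] at hv
      cases hv

theorem strictlyBelow_commConcat {S T : Set (List ℕ)} (hS : IsTreeFor S (extensionClass 0))
    (hT : IsTreeFor T (extensionClass 1)) :
    StrictlyBelow boundedMindChanges (tie ⊤ S T (extensionClass 0) (extensionClass 1))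
      (commConcat S T (extensionClass 0) (extensionClass 1)) :=
  ⟨tie_below_commConcat hS hT,
    not_below_of_isSwitching (isEvidence_commConcat hS hT) (isSwitching_tie hS hT)⟩

theorem strictlyBelow_tie_two {S T : Set (List ℕ)} (hS : IsTreeFor S (extensionClass 0))
    (hT : IsTreeFor T (extensionClass 1)) :
    StrictlyBelow boundedMindChanges (tie ⊤ S T (extensionClass 0) (extensionClass 1))
      (tie 2 S T (extensionClass 0) (extensionClass 1)) := by
  obtain ⟨e, he⟩ := exists_identity_index
  exact ⟨below_boundedMindChanges_of_index e fun g hg => ⟨g, tie_mono S T _ _ le_top hg, he g⟩,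
    not_below_of_isSwitching (isEvidence_tie_two S T) (isSwitching_tie hS hT)⟩

/-! ### Binary codes of records -/

/-- The record coded by a binary sequence: two consecutive bits are a tape and a symbol. -/
def unbits (f : Baire) : Baire := fun k => Nat.pair (f (2 * k)) (f (2 * k + 1))

/-- The binary code of a record. -/
def bits (g : Baire) : Baire :=
  fun m => if m % 2 = 0 then (g (m / 2)).unpair.1 else (g (m / 2)).unpair.2

/-- The finite record coded by a finite binary string. -/
def decodeBits (σ : List ℕ) : List ℕ :=
  (List.range (σ.length / 2)).map fun k => Nat.pair (σ.getD (2 * k) 0) (σ.getD (2 * k + 1) 0)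

/-- The binary code of a finite record. -/
def encodeBits (ρ : List ℕ) : List ℕ :=
  (List.range (2 * ρ.length)).map fun m =>
    if m % 2 = 0 then (ρ.getD (m / 2) 0).unpair.1 else (ρ.getD (m / 2) 0).unpair.2

theorem getD_res (f : Baire) {n k : ℕ} (h : k < n) : (res f n).getD k 0 = f k := by
  rw [List.getD_eq_getElem?_getD, getElem?_res f h, Option.getD_some]

@[simp] theorem unbits_bits (g : Baire) : unbits (bits g) = g := by
  funext k
  have h1 : (2 * k + 1) / 2 = k := by omega
  have h2 : (2 * k + 1) % 2 = 1 := by omega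
  simp [unbits, bits, h1, h2]

theorem decodeBits_res (f : Baire) (n : ℕ) : decodeBits (res f n) = res (unbits f) (n / 2) := by
  rw [decodeBits, res_length]
  conv_rhs => rw [res]
  refine List.map_congr_left fun k hk => ?_
  have hk := List.mem_range.1 hk
  rw [getD_res f (by omega), getD_res f (by omega), unbits]

theorem encodeBits_res (g : Baire) (n : ℕ) : encodeBits (res g n) = res (bits g) (2 * n) := by
  rw [encodeBits, res_length]
  conv_rhs => rw [res]
  refine List.map_congr_left fun m hm => ?_
  have hm := List.mem_range.1 hm
  rw [getD_res g (by omega), bits]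

theorem primrec_decodeBits : Primrec decodeBits := by
  have h2 : Primrec₂ fun (_ : List ℕ) (k : ℕ) => 2 * k :=
    Primrec.nat_mul.comp (Primrec.const 2) Primrec.snd
  refine Primrec.list_map (Primrec.list_range.comp
    (Primrec.nat_div.comp Primrec.list_length (Primrec.const 2))) ?_
  exact Primrec₂.natPair.comp ((Primrec.list_getD 0).comp Primrec.fst h2)
    ((Primrec.list_getD 0).comp Primrec.fst (Primrec.succ.comp h2))

theorem primrec_encodeBits : Primrec encodeBits := by
  have hv : Primrec fun p : List ℕ × ℕ => (p.1.getD (p.2 / 2) 0).unpair :=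
    Primrec.unpair.comp ((Primrec.list_getD 0).comp Primrec.fst
      (Primrec.nat_div.comp Primrec.snd (Primrec.const 2)))
  refine Primrec.list_map (Primrec.list_range.comp
    (Primrec.nat_mul.comp (Primrec.const 2) Primrec.list_length)) ?_
  exact Primrec.ite (Primrec.eq.comp (Primrec.nat_mod.comp Primrec.snd (Primrec.const 2))
    (Primrec.const 0)) (Primrec.fst.comp hv) (Primrec.snd.comp hv)

theorem primrec_pr (i : ℕ) : Primrec (pr i) := by
  refine Primrec.listFilterMap Primrec.id ?_
  have h : Primrec fun p : List ℕ × ℕ => p.2.unpair := Primrec.unpair.comp Primrec.snd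
  exact Primrec.ite (Primrec.eq.comp (Primrec.fst.comp h) (Primrec.const i))
    (Primrec.option_some.comp (Primrec.snd.comp h)) (Primrec.const none)

/-- The number of changes of the tape of `g` between positions `0` and `n`. -/
def flipCount (g : Baire) (n : ℕ) : ℕ :=
  ((Finset.range n).filter fun k => (g k).unpair.1 ≠ (g (k + 1)).unpair.1).card

theorem flipCount_mono (g : Baire) {m n : ℕ} (h : m ≤ n) : flipCount g m ≤ flipCount g n :=
  Finset.card_le_card (Finset.filter_subset_filter _ (Finset.range_mono h))

/-- The tape of the `k`-th symbol of a finite record. -/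
def tapeAt (k : ℕ) (ρ : List ℕ) : ℕ := (ρ.getD k 0).unpair.1

theorem tapeAt_res (g : Baire) {n k : ℕ} (h : k < n) :
    tapeAt k (res g n) = (g k).unpair.1 := by rw [tapeAt, getD_res g h]

/-- The number of changes of the tape in a finite record. -/
def flips (ρ : List ℕ) : ℕ :=
  ((List.range (ρ.length - 1)).filter fun k => tapeAt k ρ ≠ tapeAt (k + 1) ρ).length

theorem flips_res (g : Baire) (n : ℕ) : flips (res g n) = flipCount g (n - 1) := by
  rw [flips, res_length]
  change _ = ((List.range (n - 1)).filter fun k =>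
    (g k).unpair.1 ≠ (g (k + 1)).unpair.1).length
  congr 1
  refine List.filter_congr fun k hk => ?_
  have hk := List.mem_range.1 hk
  rw [tapeAt_res g (by omega), tapeAt_res g (by omega)]

theorem primrec_tapeAt : Primrec₂ tapeAt :=
  Primrec.fst.comp (Primrec.unpair.comp ((Primrec.list_getD 0).comp Primrec.snd Primrec.fst))

theorem primrec_flips : Primrec flips := by
  have h : PrimrecRel fun (k : ℕ) (ρ : List ℕ) => tapeAt k ρ ≠ tapeAt (k + 1) ρ :=
    PrimrecPred.not (Primrec.eq.comp primrec_tapeAt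
      (primrec_tapeAt.comp (Primrec.succ.comp Primrec.fst) Primrec.snd))
  exact Primrec.list_length.comp (h.listFilter.comp (Primrec.list_range.comp
    (Primrec.nat_sub.comp Primrec.list_length (Primrec.const 1))) Primrec.id)

/-! ### Records with a bounded number of changes of the tape -/

/-- The binary codes of consistent records in which the number of changes of the tape is at most `c`
times the position of the first one. -/
def budgetTree (c : ℕ) : Set (List ℕ) :=
  {σ | (∀ x ∈ σ, x < 2) ∧
    (∀ j < (decodeBits σ).length, tapeAt j (decodeBits σ) = tapeAt 0 (decodeBits σ) ∨
      flips (decodeBits σ) ≤ c * j) ∧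
    pr 0 (decodeBits σ) ∈ extensionTree 0 ∧ pr 1 (decodeBits σ) ∈ extensionTree 1}

/-- The infinite paths of `budgetTree c`. -/
def budgetClass (c : ℕ) : Set Baire := paths (budgetTree c)

theorem res_mem_budgetTree {c n : ℕ} {f : Baire} : res f n ∈ budgetTree c ↔
    (∀ k < n, f k < 2) ∧
    (∀ j < n / 2, (unbits f j).unpair.1 = (unbits f 0).unpair.1 ∨
      flipCount (unbits f) (n / 2 - 1) ≤ c * j) ∧
    pr 0 (res (unbits f) (n / 2)) ∈ extensionTree 0 ∧
    pr 1 (res (unbits f) (n / 2)) ∈ extensionTree 1 := by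
  rw [budgetTree, Set.mem_ofPred_eq, decodeBits_res, res_length, flips_res]
  refine and_congr ?_ (and_congr_left fun _ => forall₂_congr fun j hj => ?_)
  · simp [mem_res]
  · rw [tapeAt_res _ hj, tapeAt_res _ (by omega)]

theorem mem_budgetClass {c : ℕ} {f : Baire} : f ∈ budgetClass c ↔ (∀ k, f k < 2) ∧
    (∀ n j, (unbits f j).unpair.1 = (unbits f 0).unpair.1 ∨ flipCount (unbits f) n ≤ c * j) ∧
    unbits f ∈ Con (extensionTree 0) (extensionTree 1) := by
  constructor
  · intro h
    have hb : ∀ k, f k < 2 := fun k => (res_mem_budgetTree.1 (h (k + 1))).1 k (by omega)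
    refine ⟨hb, fun n j => ?_, fun k => ?_, fun n => ?_⟩
    · refine ((res_mem_budgetTree.1 (h (2 * (n + j + 1)))).2.1 j (by omega)).imp_right ?_
      exact (flipCount_mono _ (by omega)).trans
    · rw [unbits, Nat.unpair_pair]
      exact hb _
    · have := (res_mem_budgetTree.1 (h (2 * n))).2.2
      rwa [Nat.mul_div_cancel_left n (by omega)] at this
  · rintro ⟨h1, h2, h3⟩ n
    exact res_mem_budgetTree.2 ⟨fun k _ => h1 k, fun j _ => h2 _ j, h3.2 _⟩

theorem ComputablePred.of_and {α : Type*} [Primcodable α] {p q : α → Prop} (hp : ComputablePred p)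
    (hq : ComputablePred q) : ComputablePred fun a => p a ∧ q a := by
  obtain ⟨_, hp⟩ := hp
  obtain ⟨_, hq⟩ := hq
  exact ⟨inferInstance, (Primrec.and.to_comp.comp hp hq).of_eq fun a => by simp⟩

theorem ComputablePred.of_comp {α β : Type*} [Primcodable α] [Primcodable β] {p : β → Prop}
    (hp : ComputablePred p) {f : α → β} (hf : Computable f) : ComputablePred fun a => p (f a) := by
  obtain ⟨_, hp⟩ := hp
  exact ⟨inferInstance, hp.comp hf⟩

/-- The count of tape changes only grows along a record, so each bound on it is inherited by
prefixes. -/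
theorem isTreeFor_budgetTree (c : ℕ) : IsTreeFor (budgetTree c) (budgetClass c) where
  binary σ h := h.1
  prefix_closed σ τ hστ hτ := by
    -- Padding by zeros turns `τ` into an initial segment, so that `res_mem_budgetTree` applies.
    obtain ⟨f, hf⟩ : ∃ f, τ = res f τ.length := ⟨cat τ fun _ => 0, (res_cat_length _ _).symm⟩
    have hle := hστ.length_le
    rw [hf] at hστ hτ
    rw [eq_res_of_prefix hστ]
    obtain ⟨h1, h2, h3, h4⟩ := res_mem_budgetTree.1 hτ
    have hpre := res_prefix (unbits f) (show σ.length / 2 ≤ τ.length / 2 by omega)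
    exact res_mem_budgetTree.2 ⟨fun k hk => h1 k (by omega),
      fun j hj => (h2 j (by omega)).imp_right (flipCount_mono _ (by omega)).trans,
      (isTreeFor_extensionTree 0).prefix_closed _ _ (pr_mono hpre 0) h3,
      (isTreeFor_extensionTree 1).prefix_closed _ _ (pr_mono hpre 1) h4⟩
  computable := by
    have h1 : PrimrecPred fun σ : List ℕ => ∀ x ∈ σ, x < 2 :=
      PrimrecPred.forall_mem_list (Primrec.nat_lt.comp Primrec.id (Primrec.const 2))
    have h2 : PrimrecRel fun (j : ℕ) (ρ : List ℕ) => tapeAt j ρ = tapeAt 0 ρ ∨ flips ρ ≤ c * j :=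
      PrimrecPred.or (Primrec.eq.comp primrec_tapeAt
        (primrec_tapeAt.comp (Primrec.const 0) Primrec.snd))
        (Primrec.nat_le.comp (primrec_flips.comp Primrec.snd)
          (Primrec.nat_mul.comp (Primrec.const c) Primrec.fst))
    have h3 := (primrecRel_forall_lt h2).comp
      (Primrec.list_length.comp primrec_decodeBits) primrec_decodeBits
    have h4 := fun i => ComputablePred.of_comp (isTreeFor_extensionTree i).computable
      ((primrec_pr i).comp primrec_decodeBits).to_comp
    exact h1.computablePred.of_and (h3.computablePred.of_and ((h4 0).of_and (h4 1)))
  paths_eq := rfl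

theorem symbol_mem_pr (g : Baire) (k : ℕ) :
    (g k).unpair.2 ∈ pr (g k).unpair.1 (res g (k + 1)) := by
  rw [pr_res_succ, if_pos rfl]
  exact List.mem_append_right _ (List.mem_singleton_self _)

theorem symbol_lt_of_mem_con {S T : Set (List ℕ)} (hS : IsTreeFor S (extensionClass 0))
    (hT : IsTreeFor T (extensionClass 1)) {g : Baire} (hg : g ∈ Con S T) (k : ℕ) :
    (g k).unpair.2 < 2 := by
  obtain ⟨h1, h2⟩ := mem_con_iff.1 hg
  exact (isTreeFor_pick hS hT (h1 k)).binary _ (h2 _ (h1 k) (k + 1)) _ (symbol_mem_pr g k)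

theorem bits_mem_budgetClass {c : ℕ} {g : Baire}
    (hg : g ∈ Con (extensionTree 0) (extensionTree 1))
    (h : ∀ n j, (g j).unpair.1 = (g 0).unpair.1 ∨ flipCount g n ≤ c * j) :
    bits g ∈ budgetClass c := by
  refine mem_budgetClass.2 ⟨fun m => ?_, by rwa [unbits_bits], by rwa [unbits_bits]⟩
  rw [bits]
  split_ifs
  · exact hg.1 _
  · exact symbol_lt_of_mem_con (isTreeFor_extensionTree 0) (isTreeFor_extensionTree 1) hg _

/-- A consistent record that is written on tape `i` from position `a` on. -/
theorem exists_proj_of_tape_const {S T : Set (List ℕ)} (hS : IsTreeFor S (extensionClass 0))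
    (hT : IsTreeFor T (extensionClass 1)) {g : Baire} (hg : g ∈ Con S T) {i a : ℕ} (hi : i < 2)
    (ha : ∀ n ≥ a, (g n).unpair.1 = i) : ∃ q ∈ extensionClass i, IsProj i g q := by
  have hw : g = writeOn (res g a) i fun n => (g (a + n)).unpair.2 := by
    conv_lhs => rw [← cat_res_tail g a]
    rw [writeOn]
    congr 1
    funext n
    rw [← ha (a + n) (by omega), Nat.pair_unpair]
  refine ⟨cat (pr i (res g a)) fun n => (g (a + n)).unpair.2, ?_, ?_⟩
  · have htree := isTreeFor_pick hS hT hi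
    rw [← htree.paths_eq]
    intro n
    have h1 := (mem_con_iff.1 hg).2 i hi ((res g a).length + n)
    have h2 := pr_res_writeOn (res g a) i (fun n => (g (a + n)).unpair.2) n
    rw [← hw] at h2
    rw [h2] at h1
    exact htree.prefix_closed _ _ (res_prefix _ (by omega)) h1
  · have := isProj_writeOn (res g a) i fun n => (g (a + n)).unpair.2
    rwa [← hw] at this

/-- A position `j` with a tape other than the first limits all changes to `c * j`; if there is none,
the tape is constant. Either way the record settles on one tape, and consistency makes the content
of that tape a path. -/
theorem exists_proj_of_mem_budgetClass {c : ℕ} {f : Baire} (hf : f ∈ budgetClass c) :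
    ∃ i < 2, ∃ a, (∀ n ≥ a, (unbits f n).unpair.1 = i) ∧
      ∃ q ∈ extensionClass i, IsProj i (unbits f) q := by
  obtain ⟨-, h2, h3⟩ := mem_budgetClass.1 hf
  obtain ⟨a, ha⟩ : ∃ a, ∀ n ≥ a, (unbits f n).unpair.1 = (unbits f a).unpair.1 := by
    by_cases hj : ∃ j, (unbits f j).unpair.1 ≠ (unbits f 0).unpair.1
    · obtain ⟨j, hj⟩ := hj
      refine exists_tape_const_of_finite ?_
      by_contra hinf
      obtain ⟨F, hF, hcard⟩ := Set.Infinite.exists_subset_card_eq hinf (c * j + 1)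
      have hle : F ⊆ (Finset.range (F.sup id + 1)).filter
          fun k => (unbits f k).unpair.1 ≠ (unbits f (k + 1)).unpair.1 := fun k hk =>
        Finset.mem_filter.2 ⟨Finset.mem_range.2
          (Nat.lt_succ_of_le (Finset.le_sup (f := id) hk)), hF hk⟩
      have h4 := Finset.card_le_card hle
      have h5 := (h2 (F.sup id + 1) j).resolve_left hj
      rw [flipCount] at h5
      omega
    · push Not at hj
      exact ⟨0, fun n _ => hj n⟩
  exact ⟨_, h3.1 a, a, ha, exists_proj_of_tape_const (isTreeFor_extensionTree 0)
    (isTreeFor_extensionTree 1) h3 (h3.1 a) ha⟩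

theorem bits_writeOn_mem {i : ℕ} (hi : i < 2) {q : Baire} (hq : q ∈ extensionClass i) :
    bits (writeOn [] i q) ∈ budgetClass 0 := by
  refine bits_mem_budgetClass (writeOn_mem_con (isTreeFor_extensionTree 0)
    (isTreeFor_extensionTree 1) (by simp) hi hq ?_) fun n j => Or.inl ?_
  · have hi' : 1 - i < 2 := by omega
    have := limitPoint_mem (1 - i)
    rw [← (isTreeFor_pick (isTreeFor_extensionTree 0) (isTreeFor_extensionTree 1) hi').paths_eq]
      at this
    exact this 0
  · rw [writeOn_tape_of_le (Nat.zero_le j), writeOn_tape_of_le (Nat.zero_le 0)]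

theorem budgetClass_zero_subset_one : budgetClass 0 ⊆ budgetClass 1 := fun f hf => by
  obtain ⟨h1, h2, h3⟩ := mem_budgetClass.1 hf
  exact mem_budgetClass.2 ⟨h1, fun n j => (h2 n j).imp_right fun h => by omega, h3⟩

/-- With no tape changes allowed, the first bit announces the tape for good, so it serves as
evidence and can never be revised. -/
theorem isEvidence_budgetClass_zero : IsEvidence (budgetClass 0) fun i σ => σ.head? = some i := by
  have hhead : ∀ (h : Baire) (m i : ℕ), (res h m).head? = some i ↔ 0 < m ∧ h 0 = i := by
    intro h m i
    cases m with
    | zero => simp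
    | succ k => simp [res, List.range_succ_eq_map]
  refine ⟨fun i hi h hh hq m₀ => ?_, fun h hh m₀ m₁ m₂ _ _ hm₀ hm₁ => ?_⟩
  · obtain ⟨h1, h2, h3⟩ := mem_budgetClass.1 hh
    have hconst : ∀ n, (unbits h n).unpair.1 = h 0 := by
      intro n
      have h0 : (unbits h 0).unpair.1 = h 0 := by simp [unbits]
      rw [← h0]
      by_contra hne
      obtain ⟨k, -, hk, hk'⟩ := exists_change_of_tape_ne (Nat.zero_le n) (Ne.symm hne)
      have h4 := (h2 (k + 1) n).resolve_left hne
      rw [zero_mul, Nat.le_zero, flipCount, Finset.card_eq_zero] at h4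
      exact Finset.notMem_empty k (h4 ▸ Finset.mem_filter.2 ⟨Finset.self_mem_range_succ k, hk'⟩)
    obtain ⟨q, hqm, hproj⟩ := exists_proj_of_tape_const (isTreeFor_extensionTree 0)
      (isTreeFor_extensionTree 1) h3 (h1 0) (a := 0) fun n _ => hconst n
    by_cases h0 : h 0 = i
    · exact ⟨m₀ + 1, by omega, (hhead _ _ _).2 ⟨by omega, h0⟩⟩
    · have hlt := h1 0
      rw [show h 0 = 1 - i by omega] at hqm
      -- All symbols are on one tape, so the `n`-th one is the odd bit of the `n`-th pair.
      refine absurd ⟨fun n => 2 * n + 1, fun _ v => v, ?_, Computable.snd, fun n => ?_⟩ (hq q hqm)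
      · exact (Primrec.succ.comp (Primrec.nat_mul.comp (Primrec.const 2) Primrec.id)).to_comp
      · have hlen : ∀ n, (pr (h 0) (res (unbits h) n)).length = n := by
          intro n
          induction n with
          | zero => rfl
          | succ n ih => rw [pr_res_succ, if_pos (hconst n)]; simp [ih]
        have h5 := hproj.pr_eq (n + 1)
        rw [hlen, pr_res_succ, if_pos (hconst n), hproj.pr_eq n, hlen, res_succ q] at h5
        have h6 := List.append_cancel_left h5
        simpa [unbits] using h6.symm
  · have h0 := ((hhead _ _ _).1 hm₀).2
    have h1 := ((hhead _ _ _).1 hm₁).2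
    omega

/-- The only possible new change is at the junction, between positions `n - 1` and `n`. -/
theorem flipCount_continueOn_le {i n : ℕ} {g : Baire} (m : ℕ) :
    flipCount (continueOn i (res g n)) m ≤ flipCount g (n - 1) + 1 := by
  have hlt : ∀ k < n, continueOn i (res g n) k = g k := fun k hk => by
    rw [continueOn, writeOn, cat_of_lt (by simpa using hk), getElem_res]
  have hge : ∀ k ≥ n, (continueOn i (res g n) k).unpair.1 = i := fun k hk =>
    writeOn_tape_of_le (by simpa using hk)
  refine le_trans (Finset.card_le_card ?_) (Finset.card_insert_le (n - 1) _)
  intro k hk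
  have hk := (Finset.mem_filter.1 hk).2
  have hkn : k < n := by
    by_contra hkn
    exact hk (by rw [hge k (by omega), hge (k + 1) (by omega)])
  by_cases hk1 : k = n - 1
  · exact Finset.mem_insert.2 (Or.inl hk1)
  · rw [hlt k hkn, hlt (k + 1) (by omega)] at hk
    exact Finset.mem_insert_of_mem
      (Finset.mem_filter.2 ⟨Finset.mem_range.2 (by omega), hk⟩)

theorem SimpleRed.bits {g f : Baire} (h : SimpleRed g f) : SimpleRed (bits g) f := by
  obtain ⟨G, hG, h1, h2⟩ := h
  refine ⟨fun σ => encodeBits (G σ), primrec_encodeBits.to_comp.comp hG, fun t => ?_, fun m => ?_⟩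
  · obtain ⟨m, hm⟩ := h1 t
    exact ⟨2 * m, (congrArg encodeBits hm).trans (encodeBits_res g m)⟩
  · obtain ⟨t, ht⟩ := h2 m
    refine ⟨t, ?_⟩
    simp only [encodeBits, List.length_map, List.length_range]
    omega

/-- The string `σ` codes an initial segment of a record of the limit points that may still change
its tape `N` times. -/
def HasBudget (N : ℕ) (σ : List ℕ) : Prop :=
  ∃ g n, σ = res (bits g) (2 * n) ∧ IsLimitRecord (res g n) ∧
    ∀ j, (j < n → (g j).unpair.1 ≠ (g 0).unpair.1) → flipCount g (n - 1) + N ≤ j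

/-- Each continuation costs at most one tape change, so a reserve of `N + 1` drops to at least `N`.
In `HasBudget` every `j ≥ n` counts as a possible first change, which covers records that have not
changed their tape yet. -/
theorem isSwitching_budgetClass_one : IsSwitching (budgetClass 1) HasBudget where
  anti := by
    rintro N _ ⟨g, n, rfl, h1, h2⟩
    exact ⟨g, n, rfl, h1, fun j hj => (Nat.le_succ _).trans (h2 j hj)⟩
  init N := by
    have hnil : IsLimitRecord [] := ⟨by simp, fun _ _ => rfl⟩
    have htape : ∀ n, (continueOn 0 [] n).unpair.1 = 0 := fun n =>
      writeOn_tape_of_le (Nat.zero_le n)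
    have hrec := hnil.continueOn_res (i := 0) (by omega) N
    rw [List.length_nil, Nat.zero_add] at hrec
    -- Writing `N` symbols on tape 0 delays the first change to position `N` or later, which pays
    -- for `N` switches.
    refine ⟨_, continueOn 0 [], N, rfl, hrec, fun j hj => ?_⟩
    have hf : flipCount (continueOn 0 []) (N - 1) = 0 := by simp [flipCount, htape]
    rw [hf]
    by_contra hlt
    exact hj (by omega) (by rw [htape, htape])
  ext := by
    rintro N _ ⟨g, n, rfl, h1, h2⟩ i hi
    have hlt : ∀ k < n, continueOn i (res g n) k = g k := fun k hk => by
      rw [continueOn, writeOn, cat_of_lt (by simpa using hk), getElem_res]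
    have hbud : ∀ m j, (j < n → (continueOn i (res g n) j).unpair.1 ≠
        (continueOn i (res g n) 0).unpair.1) →
          flipCount (continueOn i (res g n)) m + N ≤ j := by
      intro m j hj
      have := h2 j fun hjn => by
        have := hj hjn
        rwa [hlt j hjn, hlt 0 (by omega)] at this
      have := flipCount_continueOn_le (i := i) (n := n) (g := g) m
      omega
    refine ⟨bits (continueOn i (res g n)), bits_mem_budgetClass
      (h1.continueOn_mem_tie (isTreeFor_extensionTree 0) (isTreeFor_extensionTree 1) hi).2
      fun m j => ?_, (IsLimitRecord.simpleRed_continueOn i _).bits, ?_, fun m => ?_⟩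
    · rw [or_iff_not_imp_left]
      intro hne
      have := hbud m j fun _ => hne
      omega
    · rw [res_length, ← encodeBits_res, ← encodeBits_res]
      exact congrArg encodeBits (res_eq_res.2 hlt)
    · refine ⟨2 * (n + m), by omega, _, n + m, rfl, ?_, fun j hj => hbud _ j fun hjn =>
        hj (by omega)⟩
      have := h1.continueOn_res hi m
      rwa [res_length] at this

/-- The projection to tape `i`, as a binary code of a record that is written on tape `i` only. -/
theorem exists_projection_index (i : ℕ) : ∃ e, ∀ f q : Baire, IsProj i (unbits f) q →
    Computes e f (bits (writeOn [] i q)) := by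
  have hF : Primrec₂ fun (σ : List ℕ) (m : ℕ) =>
      if m % 2 = 0 then some i else (pr i (decodeBits σ))[m / 2]? := by
    refine Primrec.ite (Primrec.eq.comp (Primrec.nat_mod.comp Primrec.snd (Primrec.const 2))
      (Primrec.const 0)) (Primrec.const _) ?_
    exact Primrec.list_getElem?.comp ((primrec_pr i).comp (primrec_decodeBits.comp Primrec.fst))
      (Primrec.nat_div.comp Primrec.snd (Primrec.const 2))
  obtain ⟨e, he⟩ := exists_index hF.to_comp
  refine ⟨e, fun f q hq => he f _ fun m => ?_⟩
  have hw : writeOn [] i q (m / 2) = Nat.pair i (q (m / 2)) := rfl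
  rw [bits, hw, Nat.unpair_pair]
  by_cases hm : m % 2 = 0
  · simp only [if_pos hm]
    exact ⟨⟨0, trivial⟩, fun s v hv => (Option.some.inj hv).symm⟩
  · simp only [if_neg hm, decodeBits_res]
    refine ⟨?_, fun s v hv => ?_⟩
    · obtain ⟨n, hn⟩ := hq (m / 2 + 1)
      refine ⟨2 * n, ?_⟩
      rw [Nat.mul_div_cancel_left n (by omega)]
      have hlen := hn.length_le
      rw [res_length] at hlen
      rw [hq.pr_eq, getElem?_res q (by omega)]
    · rw [hq.pr_eq] at hv
      obtain ⟨h1, h2⟩ := List.getElem?_eq_some_iff.1 hv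
      simpa using h2.symm

/-- The learner always guesses the projection to the current tape. It may alternate arbitrarily
often between its two indices, which costs mind changes but no new errors. -/
theorem budgetClass_zero_below_one :
    Below boundedErrors (budgetClass 0) (budgetClass 1) := by
  choose e he using exists_projection_index
  -- The inspected position is the last even one below the length: the most recent tape bit, even if
  -- its symbol bit is still missing.
  let Ψ : List ℕ → ℕ := fun σ => if σ.getD (2 * ((σ.length - 1) / 2)) 0 = 0 then e 0 else e 1
  have hΨ : Primrec Ψ := by
    refine Primrec.ite (Primrec.eq.comp ((Primrec.list_getD 0).comp Primrec.id
      (Primrec.nat_mul.comp (Primrec.const 2) (Primrec.nat_div.comp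
        (Primrec.nat_sub.comp Primrec.list_length (Primrec.const 1)) (Primrec.const 2))))
      (Primrec.const 0)) (Primrec.const _) (Primrec.const _)
  refine below_boundedErrors Ψ hΨ.to_comp 2 (fun g _ => ?_) fun f hf => ?_
  · have hsub : indx Ψ g ⊆ {e 0, e 1} := by
      rintro _ ⟨n, rfl⟩
      by_cases h : (res g n).getD (2 * (((res g n).length - 1) / 2)) 0 = 0
      · exact Or.inl (if_pos h)
      · exact Or.inr (if_neg h)
    refine (Set.encard_le_encard hsub).trans ((Set.encard_insert_le _ _).trans ?_)
    rw [Set.encard_singleton]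
    norm_num
  · obtain ⟨i, hi, a, ha, q, hq, hproj⟩ := exists_proj_of_mem_budgetClass hf
    refine ⟨_, bits_writeOn_mem hi hq, e i, ?_, he i f q hproj⟩
    refine Filter.eventually_atTop.2 ⟨2 * a + 1, fun n hn => ?_⟩
    have h1 : (res f n).getD (2 * (((res f n).length - 1) / 2)) 0 = i := by
      rw [res_length, getD_res f (by omega), ← ha ((n - 1) / 2) (by omega), unbits,
        Nat.unpair_pair]
    simp only [Ψ, h1]
    interval_cases i
    · rfl
    · rfl

end MassProblem

theorem mainTheorem10 :
    (∃ P Q : Set Baire, IsPi01 P ∧ IsPi01 Q ∧ P.Nonempty ∧ Q.Nonempty ∧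
      ∀ S T : Set (List ℕ), IsTreeFor S P → IsTreeFor T Q →
        StrictlyBelow boundedMindChanges (tie ⊤ S T P Q) (commConcat S T P Q) ∧
        StrictlyBelow boundedMindChanges (tie ⊤ S T P Q) (tie 2 S T P Q)) ∧
    (∃ P Q : Set Baire, IsPi01 P ∧ IsPi01 Q ∧ P.Nonempty ∧ Q.Nonempty ∧
      Equivalent boundedErrors P Q ∧ StrictlyBelow boundedMindChanges P Q) := by
  obtain ⟨e, he⟩ := exists_identity_index
  have hmem : bits (writeOn [] 0 (limitPoint 0)) ∈ budgetClass 0 :=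
    bits_writeOn_mem (by omega) (limitPoint_mem 0)
  refine ⟨⟨extensionClass 0, extensionClass 1, ⟨_, isTreeFor_extensionTree 0⟩,
    ⟨_, isTreeFor_extensionTree 1⟩, ⟨_, limitPoint_mem 0⟩, ⟨_, limitPoint_mem 1⟩, fun S T hS hT =>
    ⟨strictlyBelow_commConcat hS hT, strictlyBelow_tie_two hS hT⟩⟩,
    ⟨budgetClass 1, budgetClass 0, ⟨_, isTreeFor_budgetTree 1⟩, ⟨_, isTreeFor_budgetTree 0⟩,
      ⟨_, budgetClass_zero_subset_one hmem⟩, ⟨_, hmem⟩, ⟨?_, budgetClass_zero_below_one⟩, ?_, ?_⟩⟩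
  · exact below_boundedErrors_of_index e fun g hg => ⟨g, budgetClass_zero_subset_one hg, he g⟩
  · exact below_boundedMindChanges_of_index e fun g hg =>
      ⟨g, budgetClass_zero_subset_one hg, he g⟩
  · exact not_below_of_isSwitching isEvidence_budgetClass_zero isSwitching_budgetClass_one
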